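/- **Setting.** Let $\mathcal S$ be a finite state space, $\mathcal A$ an action space, $\phi:\mathcal S\times\mathcal A\to\mathbb R^d$ and $\psi:\mathcal S\to\mathbb R^{d'}$ feature maps such that $\mathbf K_\psi=\sum_{s}\psi(s)\psi(s)^\top$ is invertible. There are $P\ge 1$ tasks. Task $p$ has the transition probabilities $$\Pr\nolimits^{(p)}(\tilde s\mid s,a)=\phi(s,a)^\top \mathbf M_\star^{(p)}\psi(\tilde s),\qquad \mathbf M_\star^{(p)}=\mathbf B_\star\mathbf A_\star^{(p)},$$ where $\mathbf B_\star\in\mathcal P_{d,r}$, the set of $d\times r$ matrices with orthonormal columns, and $\mathbf A_\star^{(p)}\in\mathbb R^{r\times d'}$. Assume $\|\phi(s,a)\|_2\le L_\phi$, $\|\psi(s)\|_2\le L_\psi$ and $\|\mathbf M_\star^{(p)}[:,i]\|_2\le S$ for all $s,a,p,i$, and put $$R=\|\mathbf K_\psi^{-1}\|L_\psi+SL_\phi ,\qquad b=2Rd'SL_\psi .$$ Assume the normalization $2RSL_\phi\ge 1$ of these (known) upper bounds. A learner interacts with all tasks in episodes $n=1,2,\dots$ of $H\ge1$ stages. In stage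 $h$ of episode $n$ of task $p$ it plays $a^{(p)}_{n,h}$ in state $s^{(p)}_{n,h}$ and the next state is $s^{(p)}_{n,h+1}$. The transitions take place one after another in some order; actions and initial states may depend on everything observed before, and each next state has, conditionally on everything observed before its transition, the law $\Pr^{(p)}(\cdot\mid s^{(p)}_{n,h},a^{(p)}_{n,h})$. Write $\phi^{(p)}_{n,h}=\phi(s^{(p)}_{n,h},a^{(p)}_{n,h})$ and $\psi^{(p)}_{n,h}=\psi(s^{(p)}_{n,h+1})$. Let $\lambda\ge0$. For every $n\ge 1$ let $(\widetilde{\mathbf B}_n,\widetilde{\mathbf A}^{(1)}_n,\dots,\widetilde{\mathbf A}^{(P)}_n)$ be any minimizer of $$\sum_{p\in[P]}\Big(\lambda\|\mathbf A^{(p)}\|_F^2+\sum_{n'<n,\,h\le H}\big\|(\psi^{(p)}_{n',h})^\top\mathbf K_\psi^{-1}-(\phi^{(p)}_{n',h})^\top\mathbf B\mathbf A^{(p)}\big\|_2^2\Big)$$ over $\mathbf B\in\mathcal P_{d,r}$ and $\|\mathbf A^{(p)}\|_F\le\sqrt{d'}\,S$, $p\in[P]$. **Claim.** For every $\delta\in(0,1)$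 there is an event of probability at least $1-\delta$ on which, for all $n\ge1$ simultaneously and all such minimizers, $$\sum_{p\in[P]}\Big(\lambda\big\|\widetilde{\mathbf A}_n^{(p)}\big\|_F^2+\tfrac12\big\|(\Sigma_n^{(p)})^{1/2}\big(\mathbf B_\star\mathbf A_\star^{(p)}-\widetilde{\mathbf B}_n\widetilde{\mathbf A}_n^{(p)}\big)\big\|_F^2\Big)\le\beta'_{nH}(\delta)+\sum_{p\in[P]}\lambda\|\mathbf A_\star^{(p)}\|_F^2 ,$$ where $$\beta'_{nH}(\delta)=1+L_\phi S+\frac{b^2}{2R^2}+(12R^2+b)\Big(2\ln\ln(2nHP)+3+\ln\tfrac1\delta+(dr+rd'P)\big(\ln(5S)+\ln(nHP)+\ln(2RL_\phi)\big)\Big).$$ Here $\Sigma_n^{(p)}=\sum_{n'<n,\,h\le H}\phi^{(p)}_{n',h}(\phi^{(p)}_{n',h})^\top$. If moreover $\lambda S^2\le R^2$, then the same inequality also holds, on the same event, for the regularized matrix $\Sigma_n^{(p)}=\lambda\mathbb I+\sum_{n'<n,\,h\le H}\phi^{(p)}_{n',h}(\phi^{(p)}_{n',h})^\top$. -/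

import Mathlib

open MeasureTheory
open scoped Matrix MatrixOrder

namespace SharedMatrixRL

/-- Euclidean norm of a vector. -/
noncomputable def l2Norm {k : ℕ} (v : Fin k → ℝ) : ℝ := ‖WithLp.toLp 2 v‖

/-- Frobenius norm of a matrix. -/
noncomputable def frobNorm {k l : ℕ} (A : Matrix (Fin k) (Fin l) ℝ) : ℝ :=
  Real.sqrt (∑ i, ∑ j, A i j ^ 2)

/-- Spectral norm of a square matrix: its operator norm for the Euclidean norm. -/
noncomputable def specNorm {k : ℕ} (A : Matrix (Fin k) (Fin k) ℝ) : ℝ :=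
  ‖Matrix.toEuclideanCLM (n := Fin k) (𝕜 := ℝ) A‖

/-- `K_ψ = ∑ₛ ψ(s) ψ(s)ᵀ`. -/
def featureGram {𝒮 : Type*} [Fintype 𝒮] {d' : ℕ} (ψ : 𝒮 → Fin d' → ℝ) :
    Matrix (Fin d') (Fin d') ℝ :=
  ∑ s, Matrix.vecMulVec (ψ s) (ψ s)

/-- The bilinear transition function `φ(s, a)ᵀ M ψ(s')`. -/
def transProb {𝒮 𝒜 : Type*} {d d' : ℕ} (φ : 𝒮 → 𝒜 → Fin d → ℝ) (ψ : 𝒮 → Fin d' → ℝ)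
    (M : Matrix (Fin d) (Fin d') ℝ) (s : 𝒮) (a : 𝒜) (s' : 𝒮) : ℝ :=
  φ s a ⬝ᵥ (M *ᵥ ψ s')

/-- `R = ‖K_ψ⁻¹‖ L_ψ + S L_φ`. -/
noncomputable def noiseRadius {𝒮 : Type*} [Fintype 𝒮] {d' : ℕ} (ψ : 𝒮 → Fin d' → ℝ)
    (Lφ Lψ S : ℝ) : ℝ :=
  specNorm (featureGram ψ)⁻¹ * Lψ + S * Lφ

/-- The radius `β'_{nH}(δ)`, with `b = 2 R d' S L_ψ`. -/
noncomputable def betaRadius (d r d' P H : ℕ) (Lφ Lψ S R δ : ℝ) (n : ℕ) : ℝ :=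
  let b : ℝ := 2 * R * d' * S * Lψ
  1 + Lφ * S + b ^ 2 / (2 * R ^ 2)
    + (12 * R ^ 2 + b) *
      (2 * Real.log (Real.log (2 * ((n : ℝ) * H * P))) + 3 + Real.log (1 / δ)
        + ((d : ℝ) * r + (r : ℝ) * d' * P) *
          (Real.log (5 * S) + Real.log ((n : ℝ) * H * P) + Real.log (2 * R * Lφ)))

/-- Interaction of a learner with `P` controlled Markov chains on the state space `𝒮`, the `p`-th
one having transition probabilities `q p s a s'`, in episodes `n = 1, 2, …` of `H` stages.
`X n h p` is the state of task `p` at stage `h` of episode `n` and `act n h p` the action played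
there, so that `X n (h + 1) p` is the state that the transition leads to.  The `clock` lists all
transitions one after another (in any order, for example lexicographically in `(n, h, p)` or in
`(n, p, h)`), and `ℱ t` is the information available just before the transition at time `t`.
Actions and initial states may depend on all the information available. -/
structure IsInteraction {Ω 𝒮 𝒜 : Type*} [mΩ : MeasurableSpace Ω] [MeasurableSpace 𝒮]
    [MeasurableSpace 𝒜] {P : ℕ} (μ : Measure Ω) (H : ℕ) (q : Fin P → 𝒮 → 𝒜 → 𝒮 → ℝ)
    (ℱ : Filtration ℕ mΩ) (clock : ℕ → ℕ → Fin P → ℕ)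
    (X : ℕ → ℕ → Fin P → Ω → 𝒮) (act : ℕ → ℕ → Fin P → Ω → 𝒜) : Prop where
  clock_injOn : Set.InjOn (fun i : ℕ × ℕ × Fin P => clock i.1 i.2.1 i.2.2)
    {i | 1 ≤ i.1 ∧ 1 ≤ i.2.1 ∧ i.2.1 ≤ H}
  state_measurable : ∀ n h p, 1 ≤ n → 1 ≤ h → h ≤ H →
    Measurable[ℱ (clock n h p)] (X n h p)
  action_measurable : ∀ n h p, 1 ≤ n → 1 ≤ h → h ≤ H →
    Measurable[ℱ (clock n h p)] (act n h p)
  next_measurable : ∀ n h p, 1 ≤ n → 1 ≤ h → h ≤ H →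
    Measurable[ℱ (clock n h p + 1)] (X n (h + 1) p)
  next_law : ∀ n h p, 1 ≤ n → 1 ≤ h → h ≤ H → ∀ s',
    μ[Set.indicator {ω | X n (h + 1) p ω = s'} (fun _ => (1 : ℝ)) | ℱ (clock n h p)]
      =ᵐ[μ] fun ω => q p (X n h p ω) (act n h p ω) s'

/-- The set of `d × r` matrices with orthonormal columns. -/
def orthoCols (d r : ℕ) : Set (Matrix (Fin d) (Fin r) ℝ) := {B | Bᵀ * B = 1}

/-- The constraint set of the joint least-squares problem. -/
def feasible (d r d' P : ℕ) (S : ℝ) :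
    Set (Matrix (Fin d) (Fin r) ℝ × (Fin P → Matrix (Fin r) (Fin d') ℝ)) :=
  {θ | θ.1 ∈ orthoCols d r ∧ ∀ p, frobNorm (θ.2 p) ≤ Real.sqrt d' * S}

section Data

variable {𝒮 𝒜 : Type*} {d r d' P : ℕ}

/-- The objective `F(B, A⁽¹⁾, …, A⁽ᴾ⁾)` built from the episodes `1, …, n - 1` of one realization
`x` of the states and `u` of the actions. -/
noncomputable def objective [Fintype 𝒮] (φ : 𝒮 → 𝒜 → Fin d → ℝ) (ψ : 𝒮 → Fin d' → ℝ)
    (lam : ℝ) (H : ℕ) (x : ℕ → ℕ → Fin P → 𝒮) (u : ℕ → ℕ → Fin P → 𝒜) (n : ℕ)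
    (θ : Matrix (Fin d) (Fin r) ℝ × (Fin P → Matrix (Fin r) (Fin d') ℝ)) : ℝ :=
  ∑ p, (lam * frobNorm (θ.2 p) ^ 2
    + ∑ k ∈ Finset.Ico 1 n, ∑ h ∈ Finset.Icc 1 H,
        l2Norm (ψ (x k (h + 1) p) ᵥ* (featureGram ψ)⁻¹
          - φ (x k h p) (u k h p) ᵥ* (θ.1 * θ.2 p)) ^ 2)

/-- `(B̃ₙ, Ãₙ⁽¹⁾, …, Ãₙ⁽ᴾ⁾)` is a minimizer of the objective over the constraint set. -/
def IsEstimate [Fintype 𝒮] (φ : 𝒮 → 𝒜 → Fin d → ℝ) (ψ : 𝒮 → Fin d' → ℝ)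
    (lam S : ℝ) (H : ℕ) (x : ℕ → ℕ → Fin P → 𝒮) (u : ℕ → ℕ → Fin P → 𝒜) (n : ℕ)
    (θ : Matrix (Fin d) (Fin r) ℝ × (Fin P → Matrix (Fin r) (Fin d') ℝ)) : Prop :=
  IsMinOn (objective φ ψ lam H x u n) (feasible d r d' P S) θ ∧ θ ∈ feasible d r d' P S

/-- `c I + ∑_{n' < n, h ≤ H} φ⁽ᵖ⁾_{n',h} (φ⁽ᵖ⁾_{n',h})ᵀ`: the Gram matrix of the data for `c = 0`,
the regularized one for `c = λ`. -/
def dataGram (φ : 𝒮 → 𝒜 → Fin d → ℝ) (c : ℝ) (H : ℕ)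
    (x : ℕ → ℕ → Fin P → 𝒮) (u : ℕ → ℕ → Fin P → 𝒜) (n : ℕ) (p : Fin P) :
    Matrix (Fin d) (Fin d) ℝ :=
  c • (1 : Matrix (Fin d) (Fin d) ℝ)
    + ∑ k ∈ Finset.Ico 1 n, ∑ h ∈ Finset.Icc 1 H,
        Matrix.vecMulVec (φ (x k h p) (u k h p)) (φ (x k h p) (u k h p))

end Data

end SharedMatrixRL

/-!
For a transition with features `φ`, next state `s'` and noise `ε = ψ(s')ᵀ K⁻¹ - φᵀ M⋆`, put
`v = φᵀ (M⋆ - B A)`.  The noise has conditional mean zero, because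
`∑ Pr(s') ψ(s')ᵀ K⁻¹ = φᵀ M⋆` (`sum_transProb_smul`), and the targets `ψ(s')ᵀ K⁻¹` have norm at
most `R`.
Comparing the objective at the minimizer and at the true parameters (`IsEstimate.sum_le`) gives
`∑ λ ‖Ã‖² + ∑ (‖v‖² + 2 ⟨ε, v⟩) ≤ ∑ λ ‖A⋆‖²`, so it is enough to bound `∑ (-2 ⟨ε, v⟩ - ‖v‖² / 2)`
uniformly over the constraint set.

For one fixed candidate, Hoeffding's lemma makes the exponential moment of
`(-2 ⟨ε, v⟩ - ‖v‖² / 3) / (6 R²)` at most one conditionally on the past; the product over all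
transitions, taken in the order of the clock, has expectation at most one (`integral_prod_le_one`),
and Markov's inequality gives an exponential tail (`measure_sum_score_ge_le`).  Because the
quadratic term is available as an offset, a fixed exponential scale suffices and no peeling is needed.

With `m = n H P` and `D = d r + r d' P`, uniformity comes from a net of the constraint set of
resolution proportional to `R D / (m Lφ)`, which by the volumetric bound on covering numbers has at
most `(5 m · 2 R S Lφ) ^ D` elements (`exists_feasible_net_card_le_exp`), and from a union bound
over `n` with weights `1 / (n (n + 1))` (`exists_event_of_tail_le`).  The discretization error is of
order `R² D` as soon as `m ≥ D`; for `m < D` the crude bound `2 ‖ε‖² ≤ 8 R²` per transition is good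
enough.  Since `R ≥ S Lφ` and `2 R S Lφ ≥ 1` force `2 R² ≥ 1`, everything, including the cost
`2 R² D` of the regularized Gram matrix, fits into the radius (`width_le_betaRadius`,
`sum_noise_le`).
-/

namespace SharedMatrixRL

/-! ### Euclidean and Frobenius norms -/

theorem l2Norm_sq {k : ℕ} (v : Fin k → ℝ) : l2Norm v ^ 2 = v ⬝ᵥ v := by
  rw [l2Norm, EuclideanSpace.norm_sq_eq]
  simp [dotProduct, sq]

theorem l2Norm_nonneg {k : ℕ} (v : Fin k → ℝ) : 0 ≤ l2Norm v := norm_nonneg _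

theorem abs_dotProduct_le {k : ℕ} (u v : Fin k → ℝ) : |u ⬝ᵥ v| ≤ l2Norm u * l2Norm v := by
  have h := abs_real_inner_le_norm (WithLp.toLp 2 v) (WithLp.toLp 2 u)
  rw [EuclideanSpace.inner_toLp_toLp] at h
  simpa [l2Norm, mul_comm] using h

theorem l2Norm_sub_le {k : ℕ} (u v : Fin k → ℝ) : l2Norm (u - v) ≤ l2Norm u + l2Norm v := by
  simpa [l2Norm] using norm_sub_le (WithLp.toLp 2 u) (WithLp.toLp 2 v)

theorem frobNorm_nonneg {k l : ℕ} (A : Matrix (Fin k) (Fin l) ℝ) : 0 ≤ frobNorm A :=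
  Real.sqrt_nonneg _

theorem frobNorm_sq {k l : ℕ} (A : Matrix (Fin k) (Fin l) ℝ) :
    frobNorm A ^ 2 = ∑ i, ∑ j, A i j ^ 2 :=
  Real.sq_sqrt (by positivity)

theorem frobNorm_sq_eq_trace {k l : ℕ} (A : Matrix (Fin k) (Fin l) ℝ) :
    frobNorm A ^ 2 = (Aᵀ * A).trace := by
  rw [frobNorm_sq, Finset.sum_comm]
  simp [Matrix.trace, Matrix.mul_apply, sq]

section Frobenius

open scoped Matrix.Norms.Frobenius

theorem frobNorm_eq_norm {k l : ℕ} (A : Matrix (Fin k) (Fin l) ℝ) : frobNorm A = ‖A‖ := by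
  simp [frobNorm, Matrix.frobenius_norm_def, Real.sqrt_eq_rpow]

theorem frobNorm_add_le {k l : ℕ} (A B : Matrix (Fin k) (Fin l) ℝ) :
    frobNorm (A + B) ≤ frobNorm A + frobNorm B := by
  simpa only [frobNorm_eq_norm] using norm_add_le A B

theorem frobNorm_sub_le {k l : ℕ} (A B : Matrix (Fin k) (Fin l) ℝ) :
    frobNorm (A - B) ≤ frobNorm A + frobNorm B := by
  simpa only [frobNorm_eq_norm] using norm_sub_le A B

theorem frobNorm_sub_comm {k l : ℕ} (A B : Matrix (Fin k) (Fin l) ℝ) :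
    frobNorm (A - B) = frobNorm (B - A) := by
  simpa only [frobNorm_eq_norm] using norm_sub_rev A B

theorem frobNorm_mul_le {k l m : ℕ} (A : Matrix (Fin k) (Fin l) ℝ)
    (B : Matrix (Fin l) (Fin m) ℝ) : frobNorm (A * B) ≤ frobNorm A * frobNorm B := by
  simpa only [frobNorm_eq_norm] using Matrix.frobenius_norm_mul A B

theorem l2Norm_vecMul_le {k l : ℕ} (v : Fin k → ℝ) (A : Matrix (Fin k) (Fin l) ℝ) :
    l2Norm (v ᵥ* A) ≤ l2Norm v * frobNorm A := by
  have h := Matrix.frobenius_norm_mul (Matrix.replicateRow Unit v) A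
  rw [← Matrix.replicateRow_vecMul, Matrix.frobenius_norm_replicateRow,
    Matrix.frobenius_norm_replicateRow] at h
  simpa only [frobNorm_eq_norm, l2Norm] using h

end Frobenius

/-! ### Covering numbers -/

/-- The volumetric bound on internal covering numbers of bounded sets in a finite-dimensional
normed space. -/
theorem exists_finset_cover {E : Type*} [NormedAddCommGroup E] [NormedSpace ℝ E]
    [FiniteDimensional ℝ E] (T : Set E) {ρ γ : ℝ} (hρ : 0 ≤ ρ) (hγ : 0 < γ)
    (hT : ∀ x ∈ T, ‖x‖ ≤ ρ) :
    ∃ F : Finset E, (∀ x ∈ F, x ∈ T) ∧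
      (F.card : ℝ) ≤ (1 + 2 * ρ / γ) ^ Module.finrank ℝ E ∧
      ∀ x ∈ T, ∃ y ∈ F, ‖x - y‖ ≤ γ := by
  classical
  let Sep : Finset E → Prop := fun F =>
    (∀ x ∈ F, x ∈ T) ∧ ∀ x ∈ F, ∀ y ∈ F, x ≠ y → γ ≤ ‖x - y‖
  -- Balls of radius `γ / 2` around separated points are disjoint inside the ball of radius
  -- `ρ + γ / 2`.
  have card_le : ∀ F, Sep F → (F.card : ℝ) ≤ (1 + 2 * ρ / γ) ^ Module.finrank ℝ E := by
    rintro F ⟨hFT, hF⟩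
    borelize E
    let μ : Measure E := Measure.addHaar
    have hγ2 : 0 < γ / 2 := by positivity
    have hρ2 : 0 < ρ + γ / 2 := by positivity
    have disj : Set.Pairwise (F : Set E)
        (Function.onFun Disjoint fun c => Metric.ball c (γ / 2)) := by
      intro c hc e he hce
      apply Metric.ball_disjoint_ball
      rw [dist_eq_norm]
      linarith [hF c hc e he hce]
    have sub : ⋃ c ∈ F, Metric.ball c (γ / 2) ⊆ Metric.ball (0 : E) (ρ + γ / 2) := by
      refine Set.iUnion₂_subset fun x hx => Metric.ball_subset_ball' ?_
      rw [dist_zero_right]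
      linarith [hT x (hFT x hx)]
    have I : (F.card : ENNReal) * ENNReal.ofReal ((γ / 2) ^ Module.finrank ℝ E)
          * μ (Metric.ball 0 1)
        ≤ ENNReal.ofReal ((ρ + γ / 2) ^ Module.finrank ℝ E) * μ (Metric.ball 0 1) := by
      calc _ = μ (⋃ c ∈ F, Metric.ball c (γ / 2)) := by
            rw [measure_biUnion_finset disj fun c _ => measurableSet_ball]
            simp only [μ.addHaar_ball_of_pos _ hγ2, Finset.sum_const, nsmul_eq_mul, mul_assoc]
        _ ≤ μ (Metric.ball (0 : E) (ρ + γ / 2)) := measure_mono sub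
        _ = _ := by rw [μ.addHaar_ball_of_pos _ hρ2]
    have J := (ENNReal.mul_le_mul_iff_left
      (Metric.measure_ball_pos μ (0 : E) zero_lt_one).ne' measure_ball_lt_top.ne).1 I
    have K := ENNReal.toReal_le_of_le_ofReal (pow_nonneg hρ2.le _) J
    rw [ENNReal.toReal_mul, ENNReal.toReal_natCast, ENNReal.toReal_ofReal (by positivity),
      ← le_div_iff₀ (by positivity), ← div_pow] at K
    convert! K using 2
    field_simp
    ring
  have bdd : BddAbove {k | ∃ F, Sep F ∧ F.card = k} := by
    refine ⟨⌊(1 + 2 * ρ / γ) ^ Module.finrank ℝ E⌋₊, ?_⟩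
    rintro k ⟨F, hF, rfl⟩
    exact Nat.le_floor (card_le F hF)
  obtain ⟨F, hF, hFcard⟩ := Nat.sSup_mem (s := {k | ∃ F, Sep F ∧ F.card = k})
    ⟨0, ∅, ⟨by simp, by simp⟩, rfl⟩ bdd
  refine ⟨F, hF.1, card_le F hF, fun x hx => ?_⟩
  -- A separated set of maximal cardinality is a cover.
  by_contra! hfar
  have hxF : x ∉ F := fun h => by
    have := hfar x h
    simp only [sub_self, norm_zero] at this
    linarith
  have hsep : Sep (insert x F) := by
    refine ⟨fun y hy => ?_, fun y hy z hz hyz => ?_⟩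
    · rcases Finset.mem_insert.1 hy with rfl | hy
      exacts [hx, hF.1 y hy]
    · rcases Finset.mem_insert.1 hy with hyx | hyF <;>
        rcases Finset.mem_insert.1 hz with hzx | hzF
      · exact absurd (hyx.trans hzx.symm) hyz
      · exact hyx ▸ (hfar z hzF).le
      · rw [norm_sub_rev]; exact hzx ▸ (hfar y hyF).le
      · exact hF.2 y hyF z hzF hyz
  have := le_csSup bdd ⟨_, hsep, rfl⟩
  rw [Finset.card_insert_of_notMem hxF] at this
  omega

open scoped Matrix.Norms.Frobenius in
theorem exists_frobNorm_cover {k l : ℕ} (T : Set (Matrix (Fin k) (Fin l) ℝ)) {ρ γ : ℝ}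
    (hρ : 0 ≤ ρ) (hγ : 0 < γ) (hT : ∀ A ∈ T, frobNorm A ≤ ρ) :
    ∃ F : Finset (Matrix (Fin k) (Fin l) ℝ), (∀ A ∈ F, A ∈ T) ∧
      (F.card : ℝ) ≤ (1 + 2 * ρ / γ) ^ (k * l) ∧
      ∀ A ∈ T, ∃ A' ∈ F, frobNorm (A - A') ≤ γ := by
  simp only [frobNorm_eq_norm] at hT ⊢
  simpa [Module.finrank_matrix] using exists_finset_cover T hρ hγ hT

/-! ### Matrices with orthonormal columns -/

theorem frobNorm_orthoCols_mul {d r d' : ℕ} {B : Matrix (Fin d) (Fin r) ℝ}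
    (hB : B ∈ orthoCols d r) (A : Matrix (Fin r) (Fin d') ℝ) : frobNorm (B * A) = frobNorm A := by
  have h : Bᵀ * B = 1 := hB
  rw [← sq_eq_sq₀ (frobNorm_nonneg _) (frobNorm_nonneg _), frobNorm_sq_eq_trace,
    frobNorm_sq_eq_trace, Matrix.transpose_mul, Matrix.mul_assoc, ← Matrix.mul_assoc Bᵀ, h,
    Matrix.one_mul]

theorem frobNorm_of_orthoCols {d r : ℕ} {B : Matrix (Fin d) (Fin r) ℝ}
    (hB : B ∈ orthoCols d r) : frobNorm B = Real.sqrt r := by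
  have h : Bᵀ * B = 1 := hB
  rw [← Real.sqrt_sq (frobNorm_nonneg B), frobNorm_sq_eq_trace, h]
  simp

theorem frobNorm_le_of_col_le {k l : ℕ} {A : Matrix (Fin k) (Fin l) ℝ} {S : ℝ} (hS : 0 ≤ S)
    (h : ∀ i, l2Norm (fun j => A j i) ≤ S) : frobNorm A ≤ Real.sqrt l * S := by
  refine abs_le_of_sq_le_sq' ?_ (by positivity) |>.2
  rw [frobNorm_sq, Finset.sum_comm, mul_pow, Real.sq_sqrt (by positivity)]
  calc ∑ i, ∑ j, A j i ^ 2 ≤ ∑ _i : Fin l, S ^ 2 := by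
        refine Finset.sum_le_sum fun i _ => ?_
        have := pow_le_pow_left₀ (l2Norm_nonneg _) (h i) 2
        rw [l2Norm_sq] at this
        simpa [dotProduct, sq] using this
    _ = l * S ^ 2 := by simp

/-- Two factorizations with orthonormal left factors are close when their factors are. -/
theorem frobNorm_mul_sub_mul_le {d r d' : ℕ} {B B' : Matrix (Fin d) (Fin r) ℝ}
    (hB' : B' ∈ orthoCols d r) (A A' : Matrix (Fin r) (Fin d') ℝ) :
    frobNorm (B * A - B' * A') ≤ frobNorm (B - B') * frobNorm A + frobNorm (A - A') := by
  have h : B * A - B' * A' = (B - B') * A + B' * (A - A') := by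
    rw [Matrix.sub_mul, Matrix.mul_sub]; abel
  rw [h]
  refine (frobNorm_add_le _ _).trans (add_le_add (frobNorm_mul_le _ _) ?_)
  rw [frobNorm_orthoCols_mul hB']

/-! ### The Gram matrices -/

theorem frobNorm_sqrt_mul_sq {k l : ℕ} {G : Matrix (Fin k) (Fin k) ℝ} (hG : G.PosSemidef)
    (D : Matrix (Fin k) (Fin l) ℝ) : frobNorm (CFC.sqrt G * D) ^ 2 = (Dᵀ * G * D).trace := by
  have h0 : 0 ≤ G := Matrix.nonneg_iff_posSemidef.2 hG
  have h1 : (CFC.sqrt G)ᵀ = CFC.sqrt G := by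
    have := (Matrix.nonneg_iff_posSemidef.1 (CFC.sqrt_nonneg G)).isHermitian
    simpa [Matrix.IsHermitian, Matrix.conjTranspose_eq_transpose_of_trivial] using this
  rw [frobNorm_sq_eq_trace, Matrix.transpose_mul, h1, Matrix.mul_assoc, ← Matrix.mul_assoc
    (CFC.sqrt G), CFC.sqrt_mul_sqrt_self G h0, Matrix.mul_assoc]

theorem trace_mul_vecMulVec_mul {k l : ℕ} (v : Fin k → ℝ) (D : Matrix (Fin k) (Fin l) ℝ) :
    (Dᵀ * Matrix.vecMulVec v v * D).trace = l2Norm (v ᵥ* D) ^ 2 := by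
  rw [l2Norm_sq, Matrix.mul_vecMulVec, Matrix.vecMulVec_mul, Matrix.trace_vecMulVec,
    Matrix.mulVec_transpose]

/-- The Gram norm of a matrix is the sum of the squared predictions on the data, plus `c` times the
squared Frobenius norm. -/
theorem frobNorm_sqrt_dataGram_mul_sq {𝒮 𝒜 : Type*} {d l P : ℕ} (φ : 𝒮 → 𝒜 → Fin d → ℝ) {c : ℝ}
    (hc : 0 ≤ c) (H : ℕ) (x : ℕ → ℕ → Fin P → 𝒮) (u : ℕ → ℕ → Fin P → 𝒜) (n : ℕ) (p : Fin P)
    (D : Matrix (Fin d) (Fin l) ℝ) :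
    frobNorm (CFC.sqrt (dataGram φ c H x u n p) * D) ^ 2
      = c * frobNorm D ^ 2
        + ∑ k ∈ Finset.Ico 1 n, ∑ h ∈ Finset.Icc 1 H,
            l2Norm (φ (x k h p) (u k h p) ᵥ* D) ^ 2 := by
  have hps : (dataGram φ c H x u n p).PosSemidef := by
    refine (Matrix.PosSemidef.one.smul hc).add ?_
    refine Matrix.posSemidef_sum _ fun k _ => Matrix.posSemidef_sum _ fun h _ => ?_
    simpa using Matrix.posSemidef_vecMulVec_self_star (φ (x k h p) (u k h p))
  rw [frobNorm_sqrt_mul_sq hps, frobNorm_sq_eq_trace]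
  simp only [← trace_mul_vecMulVec_mul, dataGram, Matrix.mul_add, Matrix.add_mul, Matrix.mul_sum,
    Matrix.sum_mul, Matrix.trace_add, Matrix.trace_sum, Matrix.mul_smul, Matrix.smul_mul,
    Matrix.trace_smul, Matrix.mul_one, smul_eq_mul]

theorem featureGram_transpose {𝒮 : Type*} [Fintype 𝒮] {d' : ℕ} (ψ : 𝒮 → Fin d' → ℝ) :
    (featureGram ψ)ᵀ = featureGram ψ := by
  simp [featureGram, Matrix.transpose_sum, Matrix.transpose_vecMulVec]

theorem specNorm_nonneg {k : ℕ} (A : Matrix (Fin k) (Fin k) ℝ) : 0 ≤ specNorm A := norm_nonneg _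

theorem l2Norm_mulVec_le {k : ℕ} (A : Matrix (Fin k) (Fin k) ℝ) (v : Fin k → ℝ) :
    l2Norm (A *ᵥ v) ≤ specNorm A * l2Norm v := by
  simpa [l2Norm, specNorm] using
    (Matrix.toEuclideanCLM (n := Fin k) (𝕜 := ℝ) A).le_opNorm (WithLp.toLp 2 v)

theorem l2Norm_vecMul_inv_featureGram_le {𝒮 : Type*} [Fintype 𝒮] {d' : ℕ} (ψ : 𝒮 → Fin d' → ℝ)
    (v : Fin d' → ℝ) :
    l2Norm (v ᵥ* (featureGram ψ)⁻¹) ≤ specNorm (featureGram ψ)⁻¹ * l2Norm v := by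
  rw [← Matrix.mulVec_transpose, Matrix.transpose_nonsing_inv, featureGram_transpose]
  exact l2Norm_mulVec_le _ _

/-- The regression target `ψ(s')ᵀ K⁻¹` is unbiased: its mean under the transition law is
`φ(s, a)ᵀ M`. -/
theorem sum_transProb_smul {𝒮 𝒜 : Type*} [Fintype 𝒮] {d d' : ℕ} (φ : 𝒮 → 𝒜 → Fin d → ℝ)
    (ψ : 𝒮 → Fin d' → ℝ) (hK : IsUnit (featureGram ψ).det) (M : Matrix (Fin d) (Fin d') ℝ)
    (s : 𝒮) (a : 𝒜) :
    ∑ s', transProb φ ψ M s a s' • (ψ s' ᵥ* (featureGram ψ)⁻¹) = φ s a ᵥ* M := by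
  have h : ∑ s', transProb φ ψ M s a s' • ψ s' = (φ s a ᵥ* M) ᵥ* featureGram ψ := by
    rw [featureGram, Matrix.vecMul_sum]
    refine Finset.sum_congr rfl fun s' _ => ?_
    rw [Matrix.vecMul_vecMulVec, transProb, Matrix.dotProduct_mulVec]
  simp_rw [← Matrix.smul_vecMul]
  rw [← Matrix.sum_vecMul, h, Matrix.vecMul_vecMul, Matrix.mul_nonsing_inv _ hK, Matrix.vecMul_one]

/-! ### Exponential moments -/

/-- Hoeffding's lemma for a probability vector on a finite type. -/
theorem sum_mul_exp_centered_le {𝒮 : Type*} [Fintype 𝒮] {q y : 𝒮 → ℝ} (hq : ∀ s, 0 ≤ q s)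
    (hq1 : ∑ s, q s = 1) {L : ℝ} (hy : ∀ s, |y s| ≤ L) (t : ℝ) :
    ∑ s, q s * Real.exp (t * (y s - ∑ s', q s' * y s')) ≤ Real.exp (L ^ 2 * t ^ 2 / 2) := by
  let _ : MeasurableSpace 𝒮 := ⊤
  have hsum : ∑ s, ENNReal.ofReal (q s) = 1 := by
    rw [← ENNReal.ofReal_sum_of_nonneg fun s _ => hq s, hq1, ENNReal.ofReal_one]
  let p : PMF 𝒮 := PMF.ofFintype (fun s => ENNReal.ofReal (q s)) hsum
  have hint : ∀ f : 𝒮 → ℝ, ∫ s, f s ∂p.toMeasure = ∑ s, q s * f s := by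
    intro f
    rw [PMF.integral_eq_sum]
    simp [p, ENNReal.toReal_ofReal (hq _)]
  have h := (ProbabilityTheory.hasSubgaussianMGF_of_mem_Icc (μ := p.toMeasure) (X := y) (a := -L)
    (b := L) (measurable_of_finite y).aemeasurable
    (Filter.Eventually.of_forall fun s => abs_le.1 (hy s))).mgf_le t
  rw [ProbabilityTheory.mgf, hint, hint] at h
  refine h.trans (le_of_eq ?_)
  congr 2
  simp only [NNReal.coe_pow, NNReal.coe_div, coe_nnnorm, Real.norm_eq_abs, NNReal.coe_ofNat]
  rw [div_pow, sq_abs]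
  ring

/-- Factors `g i · (Y i)` whose conditional expectation given the past of `Y i` is at most one,
taken along distinct times, have a product whose expectation is at most one. -/
theorem integral_prod_le_one {Ω 𝒮 ι : Type*} [mΩ : MeasurableSpace Ω] [Fintype 𝒮]
    [MeasurableSpace 𝒮] [MeasurableSingletonClass 𝒮] (μ : Measure Ω) [IsProbabilityMeasure μ]
    (ℱ : Filtration ℕ mΩ) (clock : ι → ℕ) (I : Finset ι) (hinj : Set.InjOn clock I)
    (Y : ι → Ω → 𝒮) (q g : ι → Ω → 𝒮 → ℝ)
    (hY : ∀ i ∈ I, Measurable[ℱ (clock i + 1)] (Y i))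
    (hlaw : ∀ i ∈ I, ∀ s, μ[Set.indicator {ω | Y i ω = s} (fun _ => (1 : ℝ)) | ℱ (clock i)]
      =ᵐ[μ] fun ω => q i ω s)
    (hg : ∀ i ∈ I, ∀ s, Measurable[ℱ (clock i)] fun ω => g i ω s)
    (hg0 : ∀ i ∈ I, ∀ ω s, 0 ≤ g i ω s)
    (hgC : ∀ i ∈ I, ∃ C, ∀ ω s, g i ω s ≤ C)
    (hqg : ∀ i ∈ I, ∀ ω, ∑ s, q i ω s * g i ω s ≤ 1) :
    ∫ ω, ∏ i ∈ I, g i ω (Y i ω) ∂μ ≤ 1 := by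
  classical
  have hsum : ∀ i ω, g i ω (Y i ω)
      = ∑ s, g i ω s * Set.indicator {ω | Y i ω = s} (fun _ => (1 : ℝ)) ω := by
    intro i ω
    rw [Finset.sum_eq_single (Y i ω)]
    · simp
    · intro s _ hs
      simp [Ne.symm hs]
    · simp
  have hind : ∀ i ∈ I, ∀ s, Measurable[ℱ (clock i + 1)]
      (Set.indicator {ω | Y i ω = s} (fun _ => (1 : ℝ))) := fun i hi s =>
    measurable_const.indicator (hY i hi (measurableSet_singleton s))
  have hmeas : ∀ i ∈ I, Measurable[ℱ (clock i + 1)] fun ω => g i ω (Y i ω) := by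
    intro i hi
    simp_rw [hsum i]
    exact Finset.measurable_sum _ fun s _ =>
      ((hg i hi s).mono (ℱ.mono (Nat.le_succ _)) le_rfl).mul (hind i hi s)
  induction I using Finset.induction_on_max_value clock with
  | empty => simp
  | insert a J ha hmax ih =>
    have hJ : ∀ i ∈ J, i ∈ insert a J := fun i hi => Finset.mem_insert_of_mem hi
    have haI : a ∈ insert a J := Finset.mem_insert_self a J
    have ih' := ih (hinj.mono (by simp)) (fun i hi => hY i (hJ i hi))
      (fun i hi => hlaw i (hJ i hi)) (fun i hi => hg i (hJ i hi)) (fun i hi => hg0 i (hJ i hi))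
      (fun i hi => hgC i (hJ i hi)) (fun i hi => hqg i (hJ i hi)) (fun i hi => hind i (hJ i hi))
      (fun i hi => hmeas i (hJ i hi))
    -- The times in `J` precede that of `a`, so the product over `J` is known at that time.
    have hlt : ∀ i ∈ J, clock i + 1 ≤ clock a := by
      intro i hi
      refine Nat.lt_of_le_of_ne (hmax i hi) fun h => ha ?_
      exact hinj (hJ i hi) haI h ▸ hi
    set W : Ω → ℝ := fun ω => ∏ i ∈ J, g i ω (Y i ω) with hW
    have hWm : Measurable[ℱ (clock a)] W :=
      Finset.measurable_prod _ fun i hi => (hmeas i (hJ i hi)).mono (ℱ.mono (hlt i hi)) le_rfl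
    have hW0 : ∀ ω, 0 ≤ W ω := fun ω => Finset.prod_nonneg fun i hi => hg0 i (hJ i hi) _ _
    choose! C hC using hgC
    have hWC : ∀ ω, W ω ≤ ∏ i ∈ J, C i := fun ω =>
      Finset.prod_le_prod (fun i hi => hg0 i (hJ i hi) _ _) fun i hi => hC i (hJ i hi) _ _
    have hm : ℱ (clock a) ≤ mΩ := ℱ.le _
    have hindm : ∀ s, Measurable (Set.indicator {ω | Y a ω = s} (fun _ => (1 : ℝ))) := fun s =>
      (hind a haI s).mono (ℱ.le _) le_rfl
    have hfm : ∀ s, Measurable[ℱ (clock a)] fun ω => W ω * g a ω s := fun s =>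
      hWm.mul (hg a haI s)
    have hf0 : ∀ s ω, 0 ≤ W ω * g a ω s := fun s ω => mul_nonneg (hW0 ω) (hg0 a haI ω s)
    have hfC : ∀ s ω, W ω * g a ω s ≤ (∏ i ∈ J, C i) * C a := fun s ω =>
      mul_le_mul (hWC ω) (hC a haI ω s) (hg0 a haI ω s) ((hW0 ω).trans (hWC ω))
    have hWint : Integrable W μ := by
      refine Integrable.of_bound (C := ∏ i ∈ J, C i) (hWm.mono hm le_rfl).aestronglyMeasurable
        (Filter.Eventually.of_forall fun ω => ?_)
      rw [Real.norm_of_nonneg (hW0 ω)]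
      exact hWC ω
    have hindint : ∀ s, Integrable (Set.indicator {ω | Y a ω = s} (fun _ => (1 : ℝ))) μ := by
      intro s
      refine Integrable.of_bound (C := 1) (hindm s).aestronglyMeasurable
        (Filter.Eventually.of_forall fun ω => ?_)
      by_cases h : Y a ω = s <;> simp [h]
    have hprodint : ∀ s, Integrable
        ((fun ω => W ω * g a ω s) * Set.indicator {ω | Y a ω = s} (fun _ => (1 : ℝ))) μ := by
      intro s
      refine (hindint s).bdd_mul (c := (∏ i ∈ J, C i) * C a)
        ((hfm s).mono hm le_rfl).aestronglyMeasurable (Filter.Eventually.of_forall fun ω => ?_)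
      rw [Real.norm_of_nonneg (hf0 s ω)]
      exact hfC s ω
    have hcond : ∀ s, μ[(fun ω => W ω * g a ω s) *
          Set.indicator {ω | Y a ω = s} (fun _ => (1 : ℝ)) | ℱ (clock a)]
        =ᵐ[μ] fun ω => W ω * g a ω s * q a ω s := by
      intro s
      refine (condExp_mul_of_stronglyMeasurable_left (hfm s).stronglyMeasurable (hprodint s)
        (hindint s)).trans ?_
      filter_upwards [hlaw a haI s] with ω hω
      rw [Pi.mul_apply, hω]
    have hqint : ∀ s, Integrable (fun ω => W ω * g a ω s * q a ω s) μ := fun s =>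
      integrable_condExp.congr (hcond s)
    have hswap : ∀ ω, W ω * ∑ s, q a ω s * g a ω s = ∑ s, W ω * g a ω s * q a ω s := by
      intro ω
      rw [Finset.mul_sum]
      exact Finset.sum_congr rfl fun s _ => by ring
    calc ∫ ω, ∏ i ∈ insert a J, g i ω (Y i ω) ∂μ
        = ∫ ω, ∑ s, ((fun ω => W ω * g a ω s) *
            Set.indicator {ω | Y a ω = s} (fun _ => (1 : ℝ))) ω ∂μ := by
          refine integral_congr_ae (Filter.Eventually.of_forall fun ω => ?_)
          simp only [Finset.prod_insert ha, Pi.mul_apply]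
          rw [hsum a ω, mul_comm, Finset.mul_sum]
          exact Finset.sum_congr rfl fun s _ => (mul_assoc _ _ _).symm
      _ = ∑ s, ∫ ω, W ω * g a ω s * q a ω s ∂μ := by
          rw [integral_finsetSum _ fun s _ => hprodint s]
          refine Finset.sum_congr rfl fun s _ => ?_
          rw [← integral_condExp hm]
          exact integral_congr_ae (hcond s)
      _ = ∫ ω, W ω * ∑ s, q a ω s * g a ω s ∂μ := by
          rw [← integral_finsetSum _ fun s _ => hqint s]
          simp_rw [hswap]
      _ ≤ ∫ ω, W ω ∂μ := by
          refine integral_mono ?_ hWint fun ω => mul_le_of_le_one_right (hW0 ω) (hqg a haI ω)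
          simp_rw [hswap]
          exact integrable_finsetSum _ fun s _ => hqint s
      _ ≤ 1 := ih'

/-- A union bound over countably many finite families of variables with exponential upper tails;
the `n`-th family is given the share `δ / (n (n + 1))` of the failure probability. -/
theorem exists_event_of_tail_le {Ω T : Type*} [MeasurableSpace Ω] (μ : Measure Ω)
    [IsProbabilityMeasure μ] (F : ℕ → Finset T) (Z : ℕ → T → Ω → ℝ) (κ : ℕ → ℝ) (c : ℝ)
    (hZ : ∀ n, 1 ≤ n → ∀ θ, Measurable (Z n θ))
    (htail : ∀ n, 1 ≤ n → ∀ θ ℓ, μ {ω | c * ℓ ≤ Z n θ ω} ≤ ENNReal.ofReal (Real.exp (-ℓ)))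
    (hF : ∀ n, 1 ≤ n → ((F n).card : ℝ) ≤ Real.exp (κ n)) {δ : ℝ} (hδ : 0 < δ) :
    ∃ E : Set Ω, MeasurableSet E ∧ ENNReal.ofReal (1 - δ) ≤ μ E ∧
      ∀ ω ∈ E, ∀ n : ℕ, 1 ≤ n → ∀ θ ∈ F n,
        Z n θ ω < c * (κ n + Real.log (n * (n + 1) / δ)) := by
  set ℓ : ℕ → ℝ := fun n => κ n + Real.log (n * (n + 1) / δ) with hℓ
  set Bad : Set Ω := ⋃ k : ℕ, ⋃ θ ∈ F (k + 1), {ω | c * ℓ (k + 1) ≤ Z (k + 1) θ ω} with hBad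
  have hBadm : MeasurableSet Bad := MeasurableSet.iUnion fun k =>
    Finset.measurableSet_biUnion _ fun θ _ =>
      measurableSet_le measurable_const (hZ (k + 1) (by omega) θ)
  have hstep : ∀ k : ℕ, μ (⋃ θ ∈ F (k + 1), {ω | c * ℓ (k + 1) ≤ Z (k + 1) θ ω})
      ≤ ENNReal.ofReal (δ * (1 / ((k : ℝ) + 1) - 1 / ((k + 1 : ℕ) + 1 : ℝ))) := by
    intro k
    have hk : (0 : ℝ) < ((k + 1 : ℕ) : ℝ) * (((k + 1 : ℕ) : ℝ) + 1) / δ := by positivity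
    calc _ ≤ ∑ θ ∈ F (k + 1), μ {ω | c * ℓ (k + 1) ≤ Z (k + 1) θ ω} :=
          measure_biUnion_finset_le _ _
      _ ≤ ∑ _θ ∈ F (k + 1), ENNReal.ofReal (Real.exp (-ℓ (k + 1))) :=
          Finset.sum_le_sum fun θ _ => htail (k + 1) (by omega) θ _
      _ = ENNReal.ofReal ((F (k + 1)).card * Real.exp (-ℓ (k + 1))) := by
          rw [Finset.sum_const, nsmul_eq_mul, ENNReal.ofReal_mul (by positivity),
            ENNReal.ofReal_natCast]
      _ ≤ ENNReal.ofReal (Real.exp (κ (k + 1)) * Real.exp (-ℓ (k + 1))) := by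
          gcongr
          exact hF (k + 1) (by omega)
      _ = _ := by
          congr 1
          rw [← Real.exp_add, hℓ]
          simp only [neg_add_rev, add_neg_cancel_comm_assoc]
          rw [Real.exp_neg, Real.exp_log hk]
          push_cast
          field_simp
          ring
  have hBadμ : μ Bad ≤ ENNReal.ofReal δ := by
    refine (measure_iUnion_le _).trans ((ENNReal.tsum_le_tsum hstep).trans ?_)
    refine ENNReal.tsum_le_of_sum_range_le fun N => ?_
    rw [← ENNReal.ofReal_sum_of_nonneg]
    · refine ENNReal.ofReal_le_ofReal ?_
      rw [← Finset.mul_sum, Finset.sum_range_sub' (fun k : ℕ => 1 / ((k : ℝ) + 1))]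
      refine mul_le_of_le_one_right hδ.le ?_
      have : (0 : ℝ) ≤ 1 / ((N : ℝ) + 1) := by positivity
      norm_num
      positivity
    · intro k _
      refine mul_nonneg hδ.le (sub_nonneg.2 ?_)
      refine one_div_le_one_div_of_le (by positivity) ?_
      push_cast
      linarith
  refine ⟨Badᶜ, hBadm.compl, ?_, fun ω hω n hn θ hθ => ?_⟩
  · rw [prob_compl_eq_one_sub hBadm, ENNReal.ofReal_sub _ hδ.le, ENNReal.ofReal_one]
    exact tsub_le_tsub_left hBadμ 1
  · by_contra! hcon
    refine hω (Set.mem_iUnion.2 ⟨n - 1, Set.mem_iUnion₂.2 ?_⟩)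
    rw [Nat.sub_add_cancel hn]
    exact ⟨θ, hθ, hcon⟩

/-! ### The noise and the offset excess loss -/

section Score

variable {𝒮 𝒜 : Type*} [Fintype 𝒮] {d d' : ℕ} (φ : 𝒮 → 𝒜 → Fin d → ℝ) (ψ : 𝒮 → Fin d' → ℝ)

/-- The noise `ψ(s')ᵀ K⁻¹ - φ(s, a)ᵀ M⋆` of the regression target of one transition. -/
noncomputable def noise (Mstar : Matrix (Fin d) (Fin d') ℝ) (s : 𝒮) (a : 𝒜) (s' : 𝒮) :
    Fin d' → ℝ :=
  ψ s' ᵥ* (featureGram ψ)⁻¹ - φ s a ᵥ* Mstar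

/-- For `v = φ(s, a)ᵀ (M⋆ - M)` and the noise `ε` of one transition, the quantity
`-2 ⟨ε, v⟩ - ‖v‖² / 3`.  The negative offset makes its exponential moment at the scale
`1 / (6 R²)` at most one. -/
noncomputable def score (Mstar M : Matrix (Fin d) (Fin d') ℝ) (s : 𝒮) (a : 𝒜) (s' : 𝒮) : ℝ :=
  -2 * (noise φ ψ Mstar s a s' ⬝ᵥ (φ s a ᵥ* (Mstar - M)))
    - 1 / 3 * l2Norm (φ s a ᵥ* (Mstar - M)) ^ 2

variable {φ ψ} {Mstar : Matrix (Fin d) (Fin d') ℝ} {R : ℝ}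

/-- The mean of the targets `ψ(s')ᵀ K⁻¹` inherits their norm bound `R`. -/
theorem l2Norm_noise_le (hK : IsUnit (featureGram ψ).det)
    (hR : ∀ s', l2Norm (ψ s' ᵥ* (featureGram ψ)⁻¹) ≤ R) {s : 𝒮} {a : 𝒜}
    (hq0 : ∀ s', 0 ≤ transProb φ ψ Mstar s a s') (hq1 : ∑ s', transProb φ ψ Mstar s a s' = 1)
    (s' : 𝒮) : l2Norm (noise φ ψ Mstar s a s') ≤ 2 * R := by
  have hmean : l2Norm (φ s a ᵥ* Mstar) ≤ R := by
    rw [← sum_transProb_smul φ ψ hK Mstar s a, l2Norm, WithLp.toLp_sum]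
    calc _ ≤ ∑ t, ‖WithLp.toLp 2 (transProb φ ψ Mstar s a t • (ψ t ᵥ* (featureGram ψ)⁻¹))‖ :=
          norm_sum_le _ _
      _ ≤ ∑ t, transProb φ ψ Mstar s a t * R := by
          refine Finset.sum_le_sum fun t _ => ?_
          rw [WithLp.toLp_smul, norm_smul, Real.norm_of_nonneg (hq0 t)]
          exact mul_le_mul_of_nonneg_left (hR t) (hq0 t)
      _ = R := by rw [← Finset.sum_mul, hq1, one_mul]
  exact (l2Norm_sub_le _ _).trans (by linarith [hR s'])

/-- By Hoeffding's lemma `-2 ⟨ε, v⟩` is sub-Gaussian with variance proxy `4 R² ‖v‖²`, which the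
offset `-‖v‖² / 3` cancels exactly at the scale `1 / (6 R²)`. -/
theorem sum_transProb_mul_exp_score_le (hK : IsUnit (featureGram ψ).det) (hR0 : 0 < R)
    (hR : ∀ s', l2Norm (ψ s' ᵥ* (featureGram ψ)⁻¹) ≤ R) {s : 𝒮} {a : 𝒜}
    (hq0 : ∀ s', 0 ≤ transProb φ ψ Mstar s a s') (hq1 : ∑ s', transProb φ ψ Mstar s a s' = 1)
    (M : Matrix (Fin d) (Fin d') ℝ) :
    ∑ s', transProb φ ψ Mstar s a s' * Real.exp (score φ ψ Mstar M s a s' / (6 * R ^ 2)) ≤ 1 := by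
  set v := φ s a ᵥ* (Mstar - M) with hv
  set y : 𝒮 → ℝ := fun s' => (ψ s' ᵥ* (featureGram ψ)⁻¹) ⬝ᵥ v with hy
  have hyb : ∀ s', |y s'| ≤ R * l2Norm v := fun s' =>
    (abs_dotProduct_le _ _).trans (mul_le_mul_of_nonneg_right (hR s') (l2Norm_nonneg v))
  have hmean : ∑ s', transProb φ ψ Mstar s a s' * y s' = (φ s a ᵥ* Mstar) ⬝ᵥ v := by
    rw [← sum_transProb_smul φ ψ hK Mstar s a, sum_dotProduct]
    simp [hy, smul_dotProduct]
  have hscore : ∀ s', score φ ψ Mstar M s a s' / (6 * R ^ 2)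
      = -(1 / (3 * R ^ 2)) * (y s' - ∑ t, transProb φ ψ Mstar s a t * y t)
        + -(l2Norm v ^ 2 / (18 * R ^ 2)) := by
    intro s'
    rw [hmean, score, noise, sub_dotProduct]
    simp only [hy, ← hv]
    field_simp
    ring
  have hoeff := sum_mul_exp_centered_le hq0 hq1 hyb (-(1 / (3 * R ^ 2)))
  simp_rw [hscore, Real.exp_add, ← mul_assoc]
  rw [← Finset.sum_mul]
  refine (mul_le_mul_of_nonneg_right hoeff (Real.exp_nonneg _)).trans ?_
  rw [← Real.exp_add]
  refine Real.exp_le_one_iff.2 (le_of_eq ?_)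
  field_simp
  ring

theorem score_le {L : ℝ} {M : Matrix (Fin d) (Fin d') ℝ} {s : 𝒮} {a : 𝒜} {s' : 𝒮}
    (h : l2Norm (noise φ ψ Mstar s a s') ≤ L) : score φ ψ Mstar M s a s' ≤ 3 * L ^ 2 := by
  have h1 := abs_le.1 (abs_dotProduct_le (noise φ ψ Mstar s a s') (φ s a ᵥ* (Mstar - M)))
  have h2 := mul_le_mul_of_nonneg_right h (l2Norm_nonneg (φ s a ᵥ* (Mstar - M)))
  rw [score]
  nlinarith [sq_nonneg (l2Norm (φ s a ᵥ* (Mstar - M)) - 3 * L)]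

theorem measurable_score [MeasurableSpace 𝒮] [MeasurableSingletonClass 𝒮] [MeasurableSpace 𝒜]
    (hφ : ∀ s, Measurable (φ s)) (M : Matrix (Fin d) (Fin d') ℝ) (s' : 𝒮) :
    Measurable fun z : 𝒮 × 𝒜 => score φ ψ Mstar M z.1 z.2 s' := by
  have h1 : Measurable fun z : 𝒮 × 𝒜 => φ z.1 z.2 :=
    measurable_from_prod_countable_right fun s => hφ s
  have h2 : Measurable fun w : Fin d → ℝ =>
      -2 * ((ψ s' ᵥ* (featureGram ψ)⁻¹ - w ᵥ* Mstar) ⬝ᵥ (w ᵥ* (Mstar - M)))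
        - 1 / 3 * l2Norm (w ᵥ* (Mstar - M)) ^ 2 := by
    simp_rw [l2Norm_sq]
    refine Continuous.measurable ?_
    fun_prop
  exact h2.comp h1

end Score

/-- The transitions observed before episode `n`, as triples (episode, stage, task). -/
def dataIdx (P H n : ℕ) : Finset (ℕ × ℕ × Fin P) :=
  Finset.Ico 1 n ×ˢ Finset.Icc 1 H ×ˢ Finset.univ

theorem mem_dataIdx {P H n : ℕ} {i : ℕ × ℕ × Fin P} :
    i ∈ dataIdx P H n ↔ (1 ≤ i.1 ∧ i.1 < n) ∧ 1 ≤ i.2.1 ∧ i.2.1 ≤ H := by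
  simp [dataIdx]

theorem card_dataIdx_le (P H n : ℕ) : ((dataIdx P H n).card : ℝ) ≤ n * H * P := by
  have : (dataIdx P H n).card ≤ n * H * P := by
    simp only [dataIdx, Finset.card_product, Nat.card_Ico, Nat.card_Icc, Finset.card_univ,
      Fintype.card_fin, Nat.add_sub_cancel]
    rw [← mul_assoc]
    gcongr
    omega
  exact_mod_cast this

theorem sum_dataIdx {P H n : ℕ} (f : ℕ → ℕ → Fin P → ℝ) :
    ∑ i ∈ dataIdx P H n, f i.1 i.2.1 i.2.2
      = ∑ p, ∑ k ∈ Finset.Ico 1 n, ∑ h ∈ Finset.Icc 1 H, f k h p := by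
  simp only [dataIdx, Finset.sum_product]
  symm
  rw [Finset.sum_comm]
  exact Finset.sum_congr rfl fun k _ => Finset.sum_comm

section Tail

variable {Ω 𝒮 𝒜 : Type*} [mΩ : MeasurableSpace Ω] [Fintype 𝒮] [MeasurableSpace 𝒮]
  [MeasurableSingletonClass 𝒮] [MeasurableSpace 𝒜] {μ : Measure Ω}
  {d d' P H : ℕ} {φ : 𝒮 → 𝒜 → Fin d → ℝ} {ψ : 𝒮 → Fin d' → ℝ}
  {Mstar : Fin P → Matrix (Fin d) (Fin d') ℝ} {R : ℝ}
  {ℱ : Filtration ℕ mΩ} {clock : ℕ → ℕ → Fin P → ℕ}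
  {X : ℕ → ℕ → Fin P → Ω → 𝒮} {act : ℕ → ℕ → Fin P → Ω → 𝒜}

theorem measurable_sum_score (hφ : ∀ s, Measurable (φ s))
    (hX : IsInteraction μ H (fun p => transProb φ ψ (Mstar p)) ℱ clock X act)
    (M : Fin P → Matrix (Fin d) (Fin d') ℝ) (n : ℕ) :
    Measurable fun ω => ∑ i ∈ dataIdx P H n, score φ ψ (Mstar i.2.2) (M i.2.2)
      (X i.1 i.2.1 i.2.2 ω) (act i.1 i.2.1 i.2.2 ω) (X i.1 (i.2.1 + 1) i.2.2 ω) := by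
  refine Finset.measurable_sum _ fun i hi => ?_
  obtain ⟨⟨h1, h2⟩, h3, h4⟩ := mem_dataIdx.1 hi
  have hm : Measurable fun z : 𝒮 × 𝒮 × 𝒜 =>
      score φ ψ (Mstar i.2.2) (M i.2.2) z.2.1 z.2.2 z.1 :=
    measurable_from_prod_countable_right fun s' => measurable_score hφ (M i.2.2) s'
  have hnext : Measurable (X i.1 (i.2.1 + 1) i.2.2) :=
    (hX.next_measurable i.1 i.2.1 i.2.2 h1 h3 h4).mono (ℱ.le _) le_rfl
  have hstate : Measurable (X i.1 i.2.1 i.2.2) :=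
    (hX.state_measurable i.1 i.2.1 i.2.2 h1 h3 h4).mono (ℱ.le _) le_rfl
  have hact : Measurable (act i.1 i.2.1 i.2.2) :=
    (hX.action_measurable i.1 i.2.1 i.2.2 h1 h3 h4).mono (ℱ.le _) le_rfl
  simpa only [Function.comp_def] using hm.comp (hnext.prodMk (hstate.prodMk hact))

/-- Chernoff's bound for the total score of a fixed candidate `M`. -/
theorem measure_sum_score_ge_le [IsProbabilityMeasure μ] (hφ : ∀ s, Measurable (φ s))
    (hK : IsUnit (featureGram ψ).det) (hR0 : 0 < R)
    (hR : ∀ s', l2Norm (ψ s' ᵥ* (featureGram ψ)⁻¹) ≤ R)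
    (hq0 : ∀ p s a s', 0 ≤ transProb φ ψ (Mstar p) s a s')
    (hq1 : ∀ p s a, ∑ s', transProb φ ψ (Mstar p) s a s' = 1)
    (hX : IsInteraction μ H (fun p => transProb φ ψ (Mstar p)) ℱ clock X act)
    (M : Fin P → Matrix (Fin d) (Fin d') ℝ) (n : ℕ) (ℓ : ℝ) :
    μ {ω | 6 * R ^ 2 * ℓ ≤ ∑ i ∈ dataIdx P H n, score φ ψ (Mstar i.2.2) (M i.2.2)
      (X i.1 i.2.1 i.2.2 ω) (act i.1 i.2.1 i.2.2 ω) (X i.1 (i.2.1 + 1) i.2.2 ω)}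
      ≤ ENNReal.ofReal (Real.exp (-ℓ)) := by
  set g : ℕ × ℕ × Fin P → Ω → 𝒮 → ℝ := fun i ω s' =>
    Real.exp (score φ ψ (Mstar i.2.2) (M i.2.2) (X i.1 i.2.1 i.2.2 ω) (act i.1 i.2.1 i.2.2 ω) s'
      / (6 * R ^ 2)) with hg
  have hmom : ∫ ω, ∏ i ∈ dataIdx P H n, g i ω (X i.1 (i.2.1 + 1) i.2.2 ω) ∂μ ≤ 1 := by
    refine integral_prod_le_one μ ℱ (fun i => clock i.1 i.2.1 i.2.2) (dataIdx P H n)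
      (hX.clock_injOn.mono ?_) (fun i => X i.1 (i.2.1 + 1) i.2.2)
      (fun i ω s' => transProb φ ψ (Mstar i.2.2) (X i.1 i.2.1 i.2.2 ω)
        (act i.1 i.2.1 i.2.2 ω) s') g ?_ ?_ ?_ ?_ ?_ ?_
    · intro i hi
      obtain ⟨⟨h1, h2⟩, h3, h4⟩ := mem_dataIdx.1 hi
      exact ⟨h1, h3, h4⟩
    · intro i hi
      obtain ⟨⟨h1, h2⟩, h3, h4⟩ := mem_dataIdx.1 hi
      exact hX.next_measurable _ _ _ h1 h3 h4
    · intro i hi s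
      obtain ⟨⟨h1, h2⟩, h3, h4⟩ := mem_dataIdx.1 hi
      exact hX.next_law _ _ _ h1 h3 h4 s
    · intro i hi s
      obtain ⟨⟨h1, h2⟩, h3, h4⟩ := mem_dataIdx.1 hi
      exact (((measurable_score hφ (M i.2.2) s).comp
        ((hX.state_measurable _ _ _ h1 h3 h4).prodMk
          (hX.action_measurable _ _ _ h1 h3 h4))).div_const _).exp
    · exact fun i _ ω s => (Real.exp_pos _).le
    · refine fun i _ => ⟨Real.exp (3 * (2 * R) ^ 2 / (6 * R ^ 2)), fun ω s => ?_⟩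
      refine Real.exp_le_exp.2 (div_le_div_of_nonneg_right ?_ (by positivity))
      exact score_le (l2Norm_noise_le hK hR (hq0 _ _ _) (hq1 _ _ _) s)
    · exact fun i _ ω =>
        sum_transProb_mul_exp_score_le hK hR0 hR (hq0 _ _ _) (hq1 _ _ _) (M i.2.2)
  have hprod : ∀ ω, ∏ i ∈ dataIdx P H n, g i ω (X i.1 (i.2.1 + 1) i.2.2 ω)
      = Real.exp ((∑ i ∈ dataIdx P H n, score φ ψ (Mstar i.2.2) (M i.2.2)
      (X i.1 i.2.1 i.2.2 ω) (act i.1 i.2.1 i.2.2 ω) (X i.1 (i.2.1 + 1) i.2.2 ω))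
        / (6 * R ^ 2)) := by
    intro ω
    rw [Finset.sum_div, Real.exp_sum]
  simp_rw [hprod] at hmom
  have hint : Integrable (fun ω => Real.exp ((∑ i ∈ dataIdx P H n,
      score φ ψ (Mstar i.2.2) (M i.2.2) (X i.1 i.2.1 i.2.2 ω) (act i.1 i.2.1 i.2.2 ω)
        (X i.1 (i.2.1 + 1) i.2.2 ω)) / (6 * R ^ 2))) μ := by
    refine Integrable.of_bound
      (C := Real.exp ((∑ i ∈ dataIdx P H n, 3 * (2 * R) ^ 2) / (6 * R ^ 2)))
      ((measurable_sum_score hφ hX M n).div_const _).exp.aestronglyMeasurable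
      (Filter.Eventually.of_forall fun ω => ?_)
    rw [Real.norm_of_nonneg (Real.exp_pos _).le]
    refine Real.exp_le_exp.2 (div_le_div_of_nonneg_right ?_ (by positivity))
    exact Finset.sum_le_sum fun i _ =>
      score_le (l2Norm_noise_le hK hR (hq0 _ _ _) (hq1 _ _ _) _)
  have hmarkov := mul_meas_ge_le_integral_of_nonneg
    (Filter.Eventually.of_forall fun ω => (Real.exp_pos _).le) hint (Real.exp ℓ)
  rw [← ofReal_measureReal]
  refine ENNReal.ofReal_le_ofReal ?_
  rw [Real.exp_neg, ← one_div, le_div_iff₀' (Real.exp_pos _)]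
  refine le_trans (le_of_eq ?_) (hmarkov.trans hmom)
  congr 2
  ext ω
  simp only [Set.mem_ofPred_eq, Real.exp_le_exp]
  rw [le_div_iff₀' (by positivity)]

end Tail

/-! ### Discretization of the constraint set -/

/-- A net of the constraint set for the distance of the products `B A⁽ᵖ⁾`, as a product of nets of
the factors. -/
theorem exists_feasible_net (d r d' P : ℕ) {S γA γB : ℝ} (hS : 0 ≤ S) (hA : 0 < γA)
    (hB : 0 < γB) :
    ∃ F : Finset (Matrix (Fin d) (Fin r) ℝ × (Fin P → Matrix (Fin r) (Fin d') ℝ)),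
      (F.card : ℝ) ≤ (1 + 2 * Real.sqrt r / γB) ^ (d * r)
        * ((1 + 2 * (Real.sqrt d' * S) / γA) ^ (r * d')) ^ P ∧
      ∀ θ ∈ feasible d r d' P S, ∃ θ' ∈ F, ∀ p,
        frobNorm (θ.1 * θ.2 p - θ'.1 * θ'.2 p) ≤ γB * (Real.sqrt d' * S) + γA := by
  classical
  obtain ⟨FB, hFB, hFBc, hFBn⟩ := exists_frobNorm_cover (orthoCols d r) (Real.sqrt_nonneg r) hB
    fun B h => (frobNorm_of_orthoCols h).le
  obtain ⟨FA, hFA, hFAc, hFAn⟩ := exists_frobNorm_cover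
    {A : Matrix (Fin r) (Fin d') ℝ | frobNorm A ≤ Real.sqrt d' * S} (by positivity) hA
    fun A h => h
  refine ⟨FB ×ˢ Fintype.piFinset fun _ => FA, ?_, ?_⟩
  · rw [Finset.card_product, Fintype.card_piFinset_const]
    push_cast
    gcongr
  · rintro ⟨B, A⟩ ⟨hθB, hθA⟩
    obtain ⟨B', hB', hBB'⟩ := hFBn B hθB
    choose A' hA' hAA' using fun p => hFAn (A p) (hθA p)
    refine ⟨(B', A'), Finset.mem_product.2 ⟨hB', Fintype.mem_piFinset.2 hA'⟩, fun p => ?_⟩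
    exact (frobNorm_mul_sub_mul_le (hFB B' hB') _ _).trans
      (add_le_add (mul_le_mul hBB' (hθA p) (frobNorm_nonneg _) hB.le) (hAA' p))

/-! ### The least-squares inequality -/

/-- Comparison of the objective at a minimizer and at the true parameters. -/
theorem IsEstimate.sum_le {𝒮 𝒜 : Type*} [Fintype 𝒮] {d r d' P : ℕ} {φ : 𝒮 → 𝒜 → Fin d → ℝ}
    {ψ : 𝒮 → Fin d' → ℝ} {lam S : ℝ} {H : ℕ} {x : ℕ → ℕ → Fin P → 𝒮} {u : ℕ → ℕ → Fin P → 𝒜}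
    {n : ℕ} {B Bstar : Matrix (Fin d) (Fin r) ℝ} {A Astar : Fin P → Matrix (Fin r) (Fin d') ℝ}
    (h : IsEstimate φ ψ lam S H x u n (B, A)) (hstar : (Bstar, Astar) ∈ feasible d r d' P S) :
    ∑ p, lam * frobNorm (A p) ^ 2
        + ∑ i ∈ dataIdx P H n,
          (2 * (noise φ ψ (Bstar * Astar i.2.2) (x i.1 i.2.1 i.2.2) (u i.1 i.2.1 i.2.2)
              (x i.1 (i.2.1 + 1) i.2.2) ⬝ᵥ
            (φ (x i.1 i.2.1 i.2.2) (u i.1 i.2.1 i.2.2) ᵥ* (Bstar * Astar i.2.2 - B * A i.2.2)))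
          + l2Norm (φ (x i.1 i.2.1 i.2.2) (u i.1 i.2.1 i.2.2) ᵥ*
              (Bstar * Astar i.2.2 - B * A i.2.2)) ^ 2)
      ≤ ∑ p, lam * frobNorm (Astar p) ^ 2 := by
  have hmin : objective φ ψ lam H x u n (B, A) ≤ objective φ ψ lam H x u n (Bstar, Astar) :=
    h.1 hstar
  simp only [objective, Finset.sum_add_distrib] at hmin
  rw [← sum_dataIdx (fun k h p => l2Norm (ψ (x k (h + 1) p) ᵥ* (featureGram ψ)⁻¹
          - φ (x k h p) (u k h p) ᵥ* (B * A p)) ^ 2),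
    ← sum_dataIdx (fun k h p => l2Norm (ψ (x k (h + 1) p) ᵥ* (featureGram ψ)⁻¹
          - φ (x k h p) (u k h p) ᵥ* (Bstar * Astar p)) ^ 2)] at hmin
  have key : ∀ i : ℕ × ℕ × Fin P,
      l2Norm (ψ (x i.1 (i.2.1 + 1) i.2.2) ᵥ* (featureGram ψ)⁻¹
          - φ (x i.1 i.2.1 i.2.2) (u i.1 i.2.1 i.2.2) ᵥ* (B * A i.2.2)) ^ 2
      = l2Norm (ψ (x i.1 (i.2.1 + 1) i.2.2) ᵥ* (featureGram ψ)⁻¹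
          - φ (x i.1 i.2.1 i.2.2) (u i.1 i.2.1 i.2.2) ᵥ* (Bstar * Astar i.2.2)) ^ 2
        + (2 * (noise φ ψ (Bstar * Astar i.2.2) (x i.1 i.2.1 i.2.2) (u i.1 i.2.1 i.2.2)
              (x i.1 (i.2.1 + 1) i.2.2) ⬝ᵥ
            (φ (x i.1 i.2.1 i.2.2) (u i.1 i.2.1 i.2.2) ᵥ* (Bstar * Astar i.2.2 - B * A i.2.2)))
          + l2Norm (φ (x i.1 i.2.1 i.2.2) (u i.1 i.2.1 i.2.2) ᵥ*
              (Bstar * Astar i.2.2 - B * A i.2.2)) ^ 2) := by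
    intro i
    rw [noise]
    set y := ψ (x i.1 (i.2.1 + 1) i.2.2) ᵥ* (featureGram ψ)⁻¹
    set f := φ (x i.1 i.2.1 i.2.2) (u i.1 i.2.1 i.2.2)
    have e : y - f ᵥ* (B * A i.2.2)
        = (y - f ᵥ* (Bstar * Astar i.2.2)) + f ᵥ* (Bstar * Astar i.2.2 - B * A i.2.2) := by
      rw [Matrix.vecMul_sub]; abel
    rw [e]
    simp only [l2Norm_sq, add_dotProduct, dotProduct_add]
    rw [dotProduct_comm (f ᵥ* (Bstar * Astar i.2.2 - B * A i.2.2))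
      (y - f ᵥ* (Bstar * Astar i.2.2))]
    ring
  simp_rw [key, Finset.sum_add_distrib] at hmin
  simp_rw [Finset.sum_add_distrib]
  linarith

/-- Replacing `v` by a point `v'` at distance at most `η` turns half of the quadratic term into a
third of it, which leaves the exponential moment of the right-hand side under control. -/
theorem neg_two_mul_dotProduct_sub_le {k : ℕ} {e v v' : Fin k → ℝ} {L η : ℝ} (he : l2Norm e ≤ L)
    (hv : l2Norm (v - v') ≤ η) :
    -2 * (e ⬝ᵥ v) - 1 / 2 * l2Norm v ^ 2
      ≤ -2 * (e ⬝ᵥ v') - 1 / 3 * l2Norm v' ^ 2 + (2 * L * η + η ^ 2) := by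
  obtain ⟨w, rfl⟩ : ∃ w, v = v' + w := ⟨v - v', by abel⟩
  rw [add_sub_cancel_left] at hv
  have h1 := (abs_le.1 (abs_dotProduct_le e w)).1
  have h2 : l2Norm e * l2Norm w ≤ L * η :=
    mul_le_mul he hv (l2Norm_nonneg _) ((l2Norm_nonneg _).trans he)
  have h3 : l2Norm w ^ 2 ≤ η ^ 2 := pow_le_pow_left₀ (l2Norm_nonneg _) hv 2
  have h4 := sq_nonneg (l2Norm (v' + (3 : ℝ) • w))
  simp only [l2Norm_sq, dotProduct_add, add_dotProduct, dotProduct_smul, smul_dotProduct,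
    smul_eq_mul] at h3 h4 ⊢
  rw [dotProduct_comm w v'] at h4 ⊢
  linarith

/-- The bound by the size of the noise alone. -/
theorem neg_two_mul_dotProduct_sub_le_sq {k : ℕ} {e v : Fin k → ℝ} {L : ℝ} (he : l2Norm e ≤ L) :
    -2 * (e ⬝ᵥ v) - 1 / 2 * l2Norm v ^ 2 ≤ 2 * L ^ 2 := by
  have h1 := (abs_le.1 (abs_dotProduct_le e v)).1
  have h2 := mul_le_mul_of_nonneg_right he (l2Norm_nonneg v)
  nlinarith [sq_nonneg (l2Norm v - 2 * L)]

/-! ### Cardinality of the net -/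

theorem two_mul_sqrt_mul_sqrt_le {r d' D : ℝ} (hr : 0 ≤ r) (hd' : 0 ≤ d') (h : r * d' + 1 ≤ D) :
    2 * (Real.sqrt r * Real.sqrt d') ≤ D := by
  rw [← Real.sqrt_mul hr]
  have := Real.sq_sqrt (mul_nonneg hr hd')
  nlinarith [sq_nonneg (Real.sqrt (r * d') - 1)]

/-- At the resolution `R D / (2 m Lφ)`, where `D = d r + r d' P`, the constraint set has a net with
at most `(5 m · 2 R S Lφ) ^ D` elements.  The resolution being proportional to `D` compensates the
radii `√r` and `√d' S` of the two factors. -/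
theorem exists_feasible_net_card_le_exp {d r d' P : ℕ} (hd : 1 ≤ d) (hr : 1 ≤ r) (hd' : 1 ≤ d')
    (hP : 1 ≤ P) {R S Lφ m D : ℝ} (hR : 0 < R) (hR2 : 1 ≤ 2 * R ^ 2) (hS : 0 < S) (hL : 0 < Lφ)
    (hU : 1 ≤ 2 * R * S * Lφ) (hm : 1 ≤ m) (hD : D = (d : ℝ) * r + (r : ℝ) * d' * P) :
    ∃ F : Finset (Matrix (Fin d) (Fin r) ℝ × (Fin P → Matrix (Fin r) (Fin d') ℝ)),
      (F.card : ℝ) ≤ Real.exp (D * Real.log (5 * (m * (2 * R * S * Lφ)))) ∧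
      ∀ θ ∈ feasible d r d' P S, ∃ θ' ∈ F, ∀ p,
        frobNorm (θ.1 * θ.2 p - θ'.1 * θ'.2 p) ≤ R * D / (2 * m * Lφ) := by
  have hd1 : (1 : ℝ) ≤ d := by exact_mod_cast hd
  have hr1 : (1 : ℝ) ≤ r := by exact_mod_cast hr
  have hd'1 : (1 : ℝ) ≤ d' := by exact_mod_cast hd'
  have hP1 : (1 : ℝ) ≤ P := by exact_mod_cast hP
  have hm0 : 0 < m := by linarith
  have hdr : (1 : ℝ) ≤ (d : ℝ) * r := one_le_mul_of_one_le_of_one_le hd1 hr1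
  have hrdP : (r : ℝ) * d' ≤ (r : ℝ) * d' * P := le_mul_of_one_le_right (by positivity) hP1
  have hDr : (r : ℝ) * d' + 1 ≤ D := by linarith
  have hD0 : 0 < D := by nlinarith
  have hsq : 1 ≤ Real.sqrt d' := Real.one_le_sqrt.2 hd'1
  have hsq0 : 0 < Real.sqrt d' := by linarith
  set γA : ℝ := R * D / (4 * m * Lφ) with hγA
  set γB : ℝ := γA / (Real.sqrt d' * S) with hγB
  have hA0 : 0 < γA := by positivity
  have hB0 : 0 < γB := by positivity
  set U : ℝ := 2 * R * S * Lφ with hUdef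
  -- `1 / R ≤ 2 R` trades the natural ratio `S Lφ / R` for the scale `U = 2 R S Lφ` of the radius.
  have hmU : 1 ≤ m * U := one_le_mul_of_one_le_of_one_le hm hU
  have hratio : 4 * m * S * Lφ / R ≤ 4 * (m * U) := by
    rw [div_le_iff₀ hR, hUdef]
    nlinarith [mul_le_mul_of_nonneg_left hR2 (show 0 ≤ 4 * m * S * Lφ by positivity)]
  have hA : 1 + 2 * (Real.sqrt d' * S) / γA ≤ 5 * (m * U) := by
    have h1 : 2 * (Real.sqrt d' * S) / γA
        = 4 * m * S * Lφ / R * (2 * (Real.sqrt 1 * Real.sqrt d') / D) := by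
      rw [hγA, Real.sqrt_one]; field_simp
    have h2 : 2 * (Real.sqrt 1 * Real.sqrt d') / D ≤ 1 :=
      (div_le_one hD0).2 (two_mul_sqrt_mul_sqrt_le zero_le_one (by positivity) (by nlinarith))
    have h3 : 4 * m * S * Lφ / R * (2 * (Real.sqrt 1 * Real.sqrt d') / D) ≤ 4 * m * S * Lφ / R :=
      mul_le_of_le_one_right (by positivity) h2
    linarith
  have hB : 1 + 2 * Real.sqrt r / γB ≤ 5 * (m * U) := by
    have h1 : 2 * Real.sqrt r / γB
        = 4 * m * S * Lφ / R * (2 * (Real.sqrt r * Real.sqrt d') / D) := by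
      rw [hγB, hγA]; field_simp
    have h2 : 2 * (Real.sqrt r * Real.sqrt d') / D ≤ 1 :=
      (div_le_one hD0).2 (two_mul_sqrt_mul_sqrt_le (by positivity) (by positivity) hDr)
    have h3 : 4 * m * S * Lφ / R * (2 * (Real.sqrt r * Real.sqrt d') / D) ≤ 4 * m * S * Lφ / R :=
      mul_le_of_le_one_right (by positivity) h2
    linarith
  obtain ⟨F, hF, hcover⟩ := exists_feasible_net d r d' P hS.le hA0 hB0
  refine ⟨F, hF.trans ?_, fun θ hθ => ?_⟩
  · have hexp : Real.exp (D * Real.log (5 * (m * U)))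
        = (5 * (m * U)) ^ (d * r) * ((5 * (m * U)) ^ (r * d')) ^ P := by
      have hpos : 0 < 5 * (m * U) := by linarith
      rw [← pow_mul, ← pow_add, mul_comm D, Real.exp_mul, Real.exp_log hpos, hD]
      exact_mod_cast Real.rpow_natCast _ _
    rw [hexp]
    gcongr
  · obtain ⟨θ', hθ', h⟩ := hcover θ hθ
    refine ⟨θ', hθ', fun p => (h p).trans (le_of_eq ?_)⟩
    rw [hγB, hγA]
    field_simp
    norm_num

/-! ### Lower bounds on the radius -/

theorem neg_one_le_log_log {x : ℝ} (hx : 2 ≤ x) : -1 ≤ Real.log (Real.log x) := by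
  have h2 : 1 / 2 ≤ Real.log x := by
    have := Real.log_le_log (by norm_num) hx
    linarith [Real.log_two_gt_d9]
  have h3 := Real.one_sub_inv_le_log_of_pos (show 0 < Real.log x by linarith)
  have h4 : (Real.log x)⁻¹ ≤ (1 / 2)⁻¹ := inv_anti₀ (by norm_num) h2
  norm_num at h4
  linarith

theorem one_le_log_five : 1 ≤ Real.log 5 := by
  rw [Real.le_log_iff_exp_le (by norm_num)]
  linarith [Real.exp_one_lt_d9]

theorem one_add_log_le_log_five_mul {m U : ℝ} (hm : 1 ≤ m) (hU : 1 ≤ U) :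
    1 + Real.log m ≤ Real.log (5 * (m * U)) := by
  rw [Real.log_mul (by norm_num) (by positivity), Real.log_mul (by positivity) (by positivity)]
  linarith [one_le_log_five, Real.log_nonneg hU]

/-- The terms of the radius that the proof uses; the terms in `b` and `Lφ S` are nonnegative and the
iterated logarithm costs at most `2`. -/
theorem le_betaRadius {d r d' P H n : ℕ} {Lφ Lψ S R δ m D : ℝ} (hR : 0 < R) (hS : 0 < S)
    (hL : 0 < Lφ) (hLψ : 0 ≤ Lψ) (hU : 1 ≤ 2 * R * S * Lφ) (hm : 1 ≤ m)
    (hmn : m = (n : ℝ) * H * P) (hδ : δ ∈ Set.Ioo (0 : ℝ) 1)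
    (hD : D = (d : ℝ) * r + (r : ℝ) * d' * P) :
    12 * R ^ 2 * (1 + Real.log (1 / δ) + D * Real.log (5 * (m * (2 * R * S * Lφ))))
      ≤ betaRadius d r d' P H Lφ Lψ S R δ n := by
  have hm0 : 0 < m := by linarith
  have hD0 : 0 ≤ D := by rw [hD]; positivity
  have hδ0 : 0 ≤ Real.log (1 / δ) := Real.log_nonneg (by
    rw [le_div_iff₀ hδ.1]; linarith [hδ.2])
  have hlog : Real.log (5 * S) + Real.log m + Real.log (2 * R * Lφ)
      = Real.log (5 * (m * (2 * R * S * Lφ))) := by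
    rw [← Real.log_mul (by positivity) (by positivity),
      ← Real.log_mul (by positivity) (by positivity)]
    congr 1
    ring
  have hΛ : 0 ≤ Real.log (5 * (m * (2 * R * S * Lφ))) := by
    linarith [one_add_log_le_log_five_mul hm hU, Real.log_nonneg hm]
  have hll := neg_one_le_log_log (x := 2 * m) (by linarith)
  simp only [betaRadius]
  rw [← hmn, ← hD, hlog]
  set Λ := D * Real.log (5 * (m * (2 * R * S * Lφ))) with hΛdef
  have hΛ' : 0 ≤ Λ := mul_nonneg hD0 hΛ
  have h1 : 12 * R ^ 2 * (1 + Real.log (1 / δ) + Λ)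
      ≤ (12 * R ^ 2 + 2 * R * d' * S * Lψ)
        * (2 * Real.log (Real.log (2 * m)) + 3 + Real.log (1 / δ) + Λ) := by
    refine mul_le_mul ?_ (by linarith) (by linarith) (by positivity)
    have : 0 ≤ 2 * R * d' * S * Lψ := by positivity
    linarith
  have h2 : 0 ≤ Lφ * S := by positivity
  have h3 : 0 ≤ (2 * R * d' * S * Lψ) ^ 2 / (2 * R ^ 2) := by positivity
  linarith

/-- The radius absorbs the confidence width of the net, the share of the union bound over `n`, the
discretization error and the regularization term. -/
theorem width_le_betaRadius {d r d' P H n : ℕ} (hn : 1 ≤ n) {Lφ Lψ S R δ m D : ℝ} (hR : 0 < R)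
    (hS : 0 < S) (hL : 0 < Lφ) (hLψ : 0 ≤ Lψ) (hU : 1 ≤ 2 * R * S * Lφ) (hnm : (n : ℝ) ≤ m)
    (hmn : m = (n : ℝ) * H * P) (hδ : δ ∈ Set.Ioo (0 : ℝ) 1)
    (hD : D = (d : ℝ) * r + (r : ℝ) * d' * P) (hD2 : 2 ≤ D) :
    6 * R ^ 2 * (D * Real.log (5 * (m * (2 * R * S * Lφ))) + Real.log (n * (n + 1) / δ))
        + 17 / 4 * (R ^ 2 * D) ≤ betaRadius d r d' P H Lφ Lψ S R δ n := by
  have hn1 : (1 : ℝ) ≤ n := by exact_mod_cast hn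
  have hm : 1 ≤ m := hn1.trans hnm
  refine le_trans ?_ (le_betaRadius hR hS hL hLψ hU hm hmn hδ hD)
  have hΛ := one_add_log_le_log_five_mul hm hU
  set Λ := Real.log (5 * (m * (2 * R * S * Lφ))) with hΛdef
  have hlm := Real.log_nonneg hm
  have hδ0 : 0 ≤ Real.log (1 / δ) := Real.log_nonneg (by
    rw [le_div_iff₀ hδ.1]; linarith [hδ.2])
  -- The factor `n (n + 1) ≤ 2 m²` of the union bound is paid for by `6 D log m` and `2 ≤ D`.
  have hw : Real.log (n * (n + 1) / δ) ≤ 2 * Real.log m + 1 + Real.log (1 / δ) := by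
    have h1 : (n : ℝ) * (n + 1) / δ ≤ m * (m * 2) * (1 / δ) := by
      rw [mul_one_div]
      refine div_le_div_of_nonneg_right ?_ hδ.1.le
      exact mul_le_mul hnm (by linarith) (by positivity) (by positivity)
    have hδ1 : 1 / δ ≠ 0 := (one_div_pos.2 hδ.1).ne'
    have h2 := Real.log_le_log (div_pos (by positivity) hδ.1) h1
    rw [Real.log_mul (by positivity) hδ1, Real.log_mul (by positivity) (by positivity),
      Real.log_mul (by positivity) (by norm_num)] at h2
    linarith [Real.log_two_lt_d9]
  have h3 : 6 * (D * Λ + Real.log (n * (n + 1) / δ)) + 17 / 4 * D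
      ≤ 12 * (1 + Real.log (1 / δ) + D * Λ) := by
    nlinarith [mul_le_mul_of_nonneg_left hΛ (show 0 ≤ D by linarith),
      mul_le_mul_of_nonneg_right hD2 hlm]
  nlinarith [mul_le_mul_of_nonneg_left h3 (sq_nonneg R)]

/-! ### The confidence set -/

/-- The deterministic part: on the event that every net point has a small total score, the noise
term of the least-squares inequality is absorbed by half of the quadratic term and the radius. -/
theorem sum_noise_le {𝒮 𝒜 : Type*} [Fintype 𝒮] {d r d' P H n : ℕ} {φ : 𝒮 → 𝒜 → Fin d → ℝ}
    {ψ : 𝒮 → Fin d' → ℝ} {Mstar M : Fin P → Matrix (Fin d) (Fin d') ℝ}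
    {x : ℕ → ℕ → Fin P → 𝒮} {u : ℕ → ℕ → Fin P → 𝒜} {Lφ Lψ S R δ m D : ℝ} (hn : 1 ≤ n)
    (hR : 0 < R) (hS : 0 < S) (hL : 0 < Lφ) (hLψ : 0 ≤ Lψ) (hU : 1 ≤ 2 * R * S * Lφ)
    (hnm : (n : ℝ) ≤ m) (hmn : m = (n : ℝ) * H * P) (hδ : δ ∈ Set.Ioo (0 : ℝ) 1)
    (hD : D = (d : ℝ) * r + (r : ℝ) * d' * P) (hD2 : 2 ≤ D)
    (hLφ : ∀ s a, l2Norm (φ s a) ≤ Lφ)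
    (hnoise : ∀ p s a s', l2Norm (noise φ ψ (Mstar p) s a s') ≤ 2 * R)
    {F : Finset (Fin P → Matrix (Fin d) (Fin d') ℝ)}
    (hnet : ∃ M' ∈ F, ∀ p, frobNorm (M p - M' p) ≤ R * D / (2 * m * Lφ))
    (hgood : ∀ M' ∈ F, ∑ i ∈ dataIdx P H n, score φ ψ (Mstar i.2.2) (M' i.2.2)
        (x i.1 i.2.1 i.2.2) (u i.1 i.2.1 i.2.2) (x i.1 (i.2.1 + 1) i.2.2)
      < 6 * R ^ 2 * (D * Real.log (5 * (m * (2 * R * S * Lφ))) + Real.log (n * (n + 1) / δ))) :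
    ∑ i ∈ dataIdx P H n,
        (-2 * (noise φ ψ (Mstar i.2.2) (x i.1 i.2.1 i.2.2) (u i.1 i.2.1 i.2.2)
            (x i.1 (i.2.1 + 1) i.2.2) ⬝ᵥ
          (φ (x i.1 i.2.1 i.2.2) (u i.1 i.2.1 i.2.2) ᵥ* (Mstar i.2.2 - M i.2.2)))
        - 1 / 2 * l2Norm (φ (x i.1 i.2.1 i.2.2) (u i.1 i.2.1 i.2.2) ᵥ*
            (Mstar i.2.2 - M i.2.2)) ^ 2)
      + 2 * (R ^ 2 * D) ≤ betaRadius d r d' P H Lφ Lψ S R δ n := by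
  have hn1 : (1 : ℝ) ≤ n := by exact_mod_cast hn
  have hm : 1 ≤ m := hn1.trans hnm
  have hm0 : 0 < m := by linarith
  have hcard : ((dataIdx P H n).card : ℝ) ≤ m := hmn ▸ card_dataIdx_le P H n
  rcases le_or_gt D m with hDm | hDm
  -- With at least `D` potential observations, pass to a net point; the discretization
  -- error is at most `9 / 4 * R² D`.
  · obtain ⟨M', hM', hMM'⟩ := hnet
    set η : ℝ := R * D / (2 * m) with hη
    have hη0 : 0 ≤ η := by positivity
    have hstep : ∀ i ∈ dataIdx P H n, _ ≤
        score φ ψ (Mstar i.2.2) (M' i.2.2) (x i.1 i.2.1 i.2.2) (u i.1 i.2.1 i.2.2)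
          (x i.1 (i.2.1 + 1) i.2.2) + (2 * (2 * R) * η + η ^ 2) := fun i _ =>
      neg_two_mul_dotProduct_sub_le
        (v := φ (x i.1 i.2.1 i.2.2) (u i.1 i.2.1 i.2.2) ᵥ* (Mstar i.2.2 - M i.2.2))
        (hnoise i.2.2 (x i.1 i.2.1 i.2.2) (u i.1 i.2.1 i.2.2) (x i.1 (i.2.1 + 1) i.2.2)) (by
          rw [← Matrix.vecMul_sub, sub_sub_sub_cancel_left]
          refine (l2Norm_vecMul_le _ _).trans ?_
          rw [frobNorm_sub_comm]
          refine (mul_le_mul (hLφ _ _) (hMM' i.2.2) (frobNorm_nonneg _) hL.le).trans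
            (le_of_eq ?_)
          rw [hη]
          field_simp)
    have hsum := Finset.sum_le_sum hstep
    rw [Finset.sum_add_distrib, Finset.sum_const, nsmul_eq_mul] at hsum
    have herr : ((dataIdx P H n).card : ℝ) * (2 * (2 * R) * η + η ^ 2)
        ≤ 9 / 4 * (R ^ 2 * D) := by
      calc _ ≤ m * (2 * (2 * R) * η + η ^ 2) := by gcongr
        _ = 2 * (R ^ 2 * D) + 1 / 4 * (R ^ 2 * D) * (D / m) := by
          rw [hη]; field_simp; ring
        _ ≤ 2 * (R ^ 2 * D) + 1 / 4 * (R ^ 2 * D) * 1 := by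
          gcongr
          exact (div_le_one hm0).2 hDm
        _ = _ := by ring
    linarith [hgood M' hM', width_le_betaRadius hn hR hS hL hLψ hU hnm hmn hδ hD hD2]
  -- With fewer than `D` observations, the squared noise alone is below the radius.
  · have hsum : _ ≤ ∑ _i ∈ dataIdx P H n, 2 * (2 * R) ^ 2 := Finset.sum_le_sum fun i _ =>
      neg_two_mul_dotProduct_sub_le_sq
        (v := φ (x i.1 i.2.1 i.2.2) (u i.1 i.2.1 i.2.2) ᵥ* (Mstar i.2.2 - M i.2.2))
        (hnoise i.2.2 (x i.1 i.2.1 i.2.2) (u i.1 i.2.1 i.2.2) (x i.1 (i.2.1 + 1) i.2.2))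
    rw [Finset.sum_const, nsmul_eq_mul] at hsum
    have hc : ((dataIdx P H n).card : ℝ) * (2 * (2 * R) ^ 2) ≤ D * (2 * (2 * R) ^ 2) := by
      gcongr
      linarith
    have hβ := le_betaRadius hR hS hL hLψ hU hm hmn hδ hD
    have hΛ : 1 ≤ Real.log (5 * (m * (2 * R * S * Lφ))) := by
      linarith [one_add_log_le_log_five_mul hm hU, Real.log_nonneg hm]
    have hδ0 : 0 ≤ Real.log (1 / δ) := Real.log_nonneg (by
      rw [le_div_iff₀ hδ.1]; linarith [hδ.2])
    have hDΛ : D ≤ 1 + Real.log (1 / δ) + D * Real.log (5 * (m * (2 * R * S * Lφ))) := by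
      nlinarith
    have := mul_le_mul_of_nonneg_left hDΛ (show 0 ≤ 12 * R ^ 2 by positivity)
    have hRD : 0 ≤ R ^ 2 * D := by positivity
    linarith

end SharedMatrixRL

theorem mainTheorem4
    {Ω 𝒮 𝒜 : Type*} [mΩ : MeasurableSpace Ω]
    [Fintype 𝒮] [MeasurableSpace 𝒮] [MeasurableSingletonClass 𝒮] [MeasurableSpace 𝒜]
    (μ : Measure Ω) [IsProbabilityMeasure μ]
    (d d' r P H : ℕ) (hP : 1 ≤ P) (hH : 1 ≤ H)
    (φ : 𝒮 → 𝒜 → Fin d → ℝ) (hφ : ∀ s, Measurable (φ s))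
    (ψ : 𝒮 → Fin d' → ℝ) (hK : IsUnit (SharedMatrixRL.featureGram ψ).det)
    (Bstar : Matrix (Fin d) (Fin r) ℝ) (hB : Bstar ∈ SharedMatrixRL.orthoCols d r)
    (Astar : Fin P → Matrix (Fin r) (Fin d') ℝ)
    (hq_nonneg : ∀ p s a s', 0 ≤ SharedMatrixRL.transProb φ ψ (Bstar * Astar p) s a s')
    (hq_sum : ∀ p s a, ∑ s', SharedMatrixRL.transProb φ ψ (Bstar * Astar p) s a s' = 1)
    (Lφ Lψ S : ℝ)
    (hLφ : ∀ s a, SharedMatrixRL.l2Norm (φ s a) ≤ Lφ)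
    (hLψ : ∀ s, SharedMatrixRL.l2Norm (ψ s) ≤ Lψ)
    (hS : ∀ p i, SharedMatrixRL.l2Norm (fun j => (Bstar * Astar p) j i) ≤ S)
    (hscale : 1 ≤ 2 * SharedMatrixRL.noiseRadius ψ Lφ Lψ S * S * Lφ)
    (lam : ℝ) (hlam : 0 ≤ lam)
    (ℱ : Filtration ℕ mΩ) (clock : ℕ → ℕ → Fin P → ℕ)
    (X : ℕ → ℕ → Fin P → Ω → 𝒮) (act : ℕ → ℕ → Fin P → Ω → 𝒜)
    (hX : SharedMatrixRL.IsInteraction μ H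
      (fun p => SharedMatrixRL.transProb φ ψ (Bstar * Astar p)) ℱ clock X act)
    (δ : ℝ) (hδ : δ ∈ Set.Ioo (0 : ℝ) 1) :
    ∃ E : Set Ω, MeasurableSet E ∧ ENNReal.ofReal (1 - δ) ≤ μ E ∧
      ∀ ω ∈ E, ∀ n : ℕ, 1 ≤ n →
        ∀ (B : Matrix (Fin d) (Fin r) ℝ) (A : Fin P → Matrix (Fin r) (Fin d') ℝ),
          SharedMatrixRL.IsEstimate φ ψ lam S H (fun k h p => X k h p ω)
            (fun k h p => act k h p ω) n (B, A) →
          ∀ c : ℝ, (c = 0 ∨ c = lam ∧ lam * S ^ 2 ≤ SharedMatrixRL.noiseRadius ψ Lφ Lψ S ^ 2) →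
          ∑ p, (lam * SharedMatrixRL.frobNorm (A p) ^ 2
              + 1 / 2 * SharedMatrixRL.frobNorm
                  (CFC.sqrt (SharedMatrixRL.dataGram φ c H (fun k h p => X k h p ω)
                      (fun k h p => act k h p ω) n p)
                    * (Bstar * Astar p - B * A p)) ^ 2)
            ≤ SharedMatrixRL.betaRadius d r d' P H Lφ Lψ S
                (SharedMatrixRL.noiseRadius ψ Lφ Lψ S) δ n
              + ∑ p, lam * SharedMatrixRL.frobNorm (Astar p) ^ 2 := by
  open SharedMatrixRL in
  set R := noiseRadius ψ Lφ Lψ S with hRdef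
  obtain ⟨ω₀⟩ : Nonempty Ω := nonempty_of_isProbabilityMeasure μ
  let p₀ : Fin P := ⟨0, hP⟩
  -- There is a transition, so some transition probability is nonzero and no dimension vanishes.
  have hq₀ := hq_sum p₀ (X 1 1 p₀ ω₀) (act 1 1 p₀ ω₀)
  have hd : 1 ≤ d := by
    by_contra! h
    obtain rfl : d = 0 := by omega
    simp [transProb] at hq₀
  have hr : 1 ≤ r := by
    by_contra! h
    obtain rfl : r = 0 := by omega
    simp [transProb] at hq₀
  have hd' : 1 ≤ d' := by
    by_contra! h
    obtain rfl : d' = 0 := by omega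
    simp [transProb] at hq₀
  have hLψ0 : 0 ≤ Lψ := (l2Norm_nonneg _).trans (hLψ (X 1 1 p₀ ω₀))
  have hLφ0 : 0 ≤ Lφ := (l2Norm_nonneg _).trans (hLφ (X 1 1 p₀ ω₀) (act 1 1 p₀ ω₀))
  have hS0 : 0 ≤ S := (l2Norm_nonneg _).trans (hS p₀ ⟨0, hd'⟩)
  have hspec : 0 ≤ specNorm (featureGram ψ)⁻¹ * Lψ := mul_nonneg (specNorm_nonneg _) hLψ0
  have hRS : S * Lφ ≤ R := by rw [hRdef, noiseRadius]; linarith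
  have hSpos : 0 < S := lt_of_le_of_ne hS0 fun h => by
    rw [← h] at hscale; norm_num at hscale
  have hLpos : 0 < Lφ := lt_of_le_of_ne hLφ0 fun h => by
    rw [← h] at hscale; norm_num at hscale
  have hR0 : 0 < R := (mul_pos hSpos hLpos).trans_le hRS
  have hR2 : 1 ≤ 2 * R ^ 2 := by nlinarith
  have hR : ∀ s', l2Norm (ψ s' ᵥ* (featureGram ψ)⁻¹) ≤ R := fun s' => by
    have h1 := l2Norm_vecMul_inv_featureGram_le ψ (ψ s')
    have h2 := mul_le_mul_of_nonneg_left (hLψ s') (specNorm_nonneg (featureGram ψ)⁻¹)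
    have h3 : 0 ≤ S * Lφ := by positivity
    rw [hRdef, noiseRadius]
    linarith
  have hfeas : (Bstar, Astar) ∈ feasible d r d' P S := ⟨hB, fun p => by
    rw [← frobNorm_orthoCols_mul hB]
    exact frobNorm_le_of_col_le hS0 (hS p)⟩
  set D : ℝ := (d : ℝ) * r + (r : ℝ) * d' * P with hD
  have hd1 : (1 : ℝ) ≤ d := by exact_mod_cast hd
  have hr1 : (1 : ℝ) ≤ r := by exact_mod_cast hr
  have hd'1 : (1 : ℝ) ≤ d' := by exact_mod_cast hd'
  have hP1 : (1 : ℝ) ≤ P := by exact_mod_cast hP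
  have hH1 : (1 : ℝ) ≤ H := by exact_mod_cast hH
  have hdr : (1 : ℝ) ≤ (d : ℝ) * r := one_le_mul_of_one_le_of_one_le hd1 hr1
  have hdP : (d' : ℝ) * P ≤ (r : ℝ) * d' * P := by
    rw [mul_assoc]; exact le_mul_of_one_le_left (by positivity) hr1
  have hdP1 : (1 : ℝ) ≤ (d' : ℝ) * P := one_le_mul_of_one_le_of_one_le hd'1 hP1
  have hD2 : 2 ≤ D := by linarith
  have hnm : ∀ n : ℕ, (n : ℝ) ≤ (n : ℝ) * H * P := fun n => by
    rw [mul_assoc]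
    exact le_mul_of_one_le_right (by positivity) (one_le_mul_of_one_le_of_one_le hH1 hP1)
  have hnet : ∀ n : ℕ, 1 ≤ n →
      ∃ F : Finset (Matrix (Fin d) (Fin r) ℝ × (Fin P → Matrix (Fin r) (Fin d') ℝ)),
        (F.card : ℝ) ≤ Real.exp (D * Real.log (5 * ((n : ℝ) * H * P * (2 * R * S * Lφ)))) ∧
        ∀ θ ∈ feasible d r d' P S, ∃ θ' ∈ F, ∀ p,
          frobNorm (θ.1 * θ.2 p - θ'.1 * θ'.2 p) ≤ R * D / (2 * ((n : ℝ) * H * P) * Lφ) :=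
    fun n hn => exists_feasible_net_card_le_exp hd hr hd' hP hR0 hR2 hSpos hLpos hscale
      ((show (1 : ℝ) ≤ n by exact_mod_cast hn).trans (hnm n)) hD
  choose! F hFcard hFcover using hnet
  obtain ⟨E, hEm, hEμ, hE⟩ := exists_event_of_tail_le μ F
    (fun n θ ω => ∑ i ∈ dataIdx P H n, score φ ψ (Bstar * Astar i.2.2) (θ.1 * θ.2 i.2.2)
      (X i.1 i.2.1 i.2.2 ω) (act i.1 i.2.1 i.2.2 ω) (X i.1 (i.2.1 + 1) i.2.2 ω))
    (fun n => D * Real.log (5 * ((n : ℝ) * H * P * (2 * R * S * Lφ)))) (6 * R ^ 2)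
    (fun n _ θ => measurable_sum_score hφ hX (fun p => θ.1 * θ.2 p) n)
    (fun n _ θ ℓ => measure_sum_score_ge_le hφ hK hR0 hR hq_nonneg hq_sum hX
      (fun p => θ.1 * θ.2 p) n ℓ) hFcard hδ.1
  refine ⟨E, hEm, hEμ, fun ω hω n hn B A hBA c hc => ?_⟩
  have hc0 : 0 ≤ c := by
    rcases hc with rfl | ⟨rfl, _⟩
    exacts [le_rfl, hlam]
  have hcS : c * S ^ 2 ≤ R ^ 2 := by
    rcases hc with rfl | ⟨rfl, h⟩
    exacts [by rw [zero_mul]; positivity, h]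
  -- The regularization of the Gram matrix costs at most `2 R² D`, by the constraint.
  have hreg : ∑ p, 1 / 2 * (c * frobNorm (Bstar * Astar p - B * A p) ^ 2) ≤ 2 * (R ^ 2 * D) := by
    have hp : ∀ p, 1 / 2 * (c * frobNorm (Bstar * Astar p - B * A p) ^ 2)
        ≤ 2 * (R ^ 2 * d') := fun p => by
      have h1 : frobNorm (Bstar * Astar p - B * A p) ≤ 2 * (Real.sqrt d' * S) := by
        refine (frobNorm_sub_le _ _).trans ?_
        rw [frobNorm_orthoCols_mul hB, frobNorm_orthoCols_mul hBA.2.1]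
        linarith [hfeas.2 p, hBA.2.2 p]
      have h2 := pow_le_pow_left₀ (frobNorm_nonneg _) h1 2
      rw [mul_pow, mul_pow, Real.sq_sqrt (by positivity)] at h2
      have h3 := mul_le_mul_of_nonneg_left h2 hc0
      have h4 := mul_le_mul_of_nonneg_right hcS (show (0 : ℝ) ≤ d' by positivity)
      linarith
    refine (Finset.sum_le_sum fun p _ => hp p).trans ?_
    rw [Finset.sum_const, Finset.card_univ, Fintype.card_fin, nsmul_eq_mul]
    have h5 : (d' : ℝ) * P ≤ D := by linarith
    have h6 := mul_le_mul_of_nonneg_left h5 (sq_nonneg R)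
    linarith
  have hls := hBA.sum_le hfeas
  classical
  have hmain := sum_noise_le (φ := φ) (ψ := ψ) (Mstar := fun p => Bstar * Astar p)
    (M := fun p => B * A p) (x := fun k h p => X k h p ω) (u := fun k h p => act k h p ω)
    (F := (F n).image fun θ p => θ.1 * θ.2 p) hn hR0 hSpos hLpos hLψ0 hscale (hnm n) rfl hδ hD hD2
    hLφ (fun p s a s' => l2Norm_noise_le hK hR (hq_nonneg p s a) (hq_sum p s a) s')
    (by
      obtain ⟨θ', hθ', h⟩ := hFcover n hn _ hBA.2
      exact ⟨_, Finset.mem_image_of_mem _ hθ', h⟩)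
    (by
      intro M' hM'
      obtain ⟨θ', hθ', rfl⟩ := Finset.mem_image.1 hM'
      exact hE ω hω n hn θ' hθ')
  simp_rw [frobNorm_sqrt_dataGram_mul_sq φ hc0, mul_add, Finset.sum_add_distrib,
    ← Finset.mul_sum, ← sum_dataIdx (fun k h p => l2Norm (φ (X k h p ω) (act k h p ω) ᵥ*
      (Bstar * Astar p - B * A p)) ^ 2)]
  simp only [Finset.sum_add_distrib, Finset.sum_sub_distrib, ← Finset.mul_sum] at hmain hls hreg
  linarith
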